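/- Let $k$ be a field, let $\Delta$ be a simplicial complex on a finite vertex set $V$ (every $v\in V$ being a vertex of $\Delta$), and let $I_\Delta\subset S=k[x_v : v\in V]$ be its Stanley–Reisner ideal, generated by the monomials $\prod_{v\in s}x_v$ with $s\subseteq V$ a non-face of $\Delta$. Let $G$ be the $1$-skeleton of $\Delta$, and let $$\cdots\to F_t\xrightarrow{\phi_t}F_{t-1}\to\cdots\xrightarrow{\phi_1}F_0\to I_\Delta\to 0$$ be the minimal graded free resolution of $I_\Delta$ over $S$ (standard grading). For $1\le p\le\infty$, the ideal $I_\Delta$ satisfies $\mathbf N_{2,p}$ if it is generated by quadrics and $\phi_t$ is represented by a matrix of linear forms for all $1\le t\le p-1$ (for all $t\ge1$ if $p=\infty$). It is $2$-regular if $F_t$ is generated in degrees $\le t+2$ for all $t\ge 0$; equivalently, $\operatorname{Tor}_t^S(I_\Delta,k)$ is concentrated in degrees $\le t+2$ for all $t$. A minimal cycle of a graph is a cycle of length $>3$ without a chord, where a chord is an edge of the graph that joins two vertices of the cycle and is not an edge of the cycle. A graph is chordal if every cycle of length $>3$ has a chord. (1) Suppose that $I_\Delta$ is generated by quadratic squarefree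 monomials. Then for every $p$ with $1<p\le\infty$, the ideal $I_\Delta$ satisfies $\mathbf N_{2,p}$ if and only if every minimal cycle in $G$ has length $\ge p+3$ (for $p=\infty$: if and only if $G$ has no minimal cycle). Moreover, $I_\Delta$ is $2$-regular if and only if $G$ is chordal. (2) (Fröberg) For arbitrary $\Delta$ as above, $I_\Delta$ is $2$-regular if and only if $\Delta$ is the clique complex of a chordal graph, that is, the complex whose faces are the cliques of that graph. -/

import Mathlib

namespace LinearSyzygies

open MvPolynomial

/-- The Stanley-Reisner ideal of `Δ` in `k[x_v : v ∈ V]`: it is generated by the squarefree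
monomials whose support is a non-face of `Δ`.  (The faces of an `AbstractSimplicialComplex` are
nonempty by convention and the empty set counts tacitly as a face; every singleton is a face, so
no variable lies in the ideal.) -/
noncomputable def stanleyReisnerIdeal (k : Type*) [Field k] {V : Type*}
    (Δ : AbstractSimplicialComplex V) : Ideal (MvPolynomial V k) :=
  Ideal.span {f | ∃ s : Finset V, s.Nonempty ∧ s ∉ Δ ∧ f = ∏ v ∈ s, X v}

/-- `I` is generated by (some set of) quadratic squarefree monomials `x_u x_v`, `u ≠ v`. -/
def IsGeneratedByQuadraticSquarefreeMonomials {k : Type*} [Field k] {V : Type*}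
    (I : Ideal (MvPolynomial V k)) : Prop :=
  ∃ E : Set (V × V), (∀ e ∈ E, e.1 ≠ e.2) ∧
    I = Ideal.span {f | ∃ e ∈ E, f = X e.1 * X e.2}

/-- The 1-skeleton of a simplicial complex, as a graph on its vertices. -/
def oneSkeleton {V : Type*} [DecidableEq V] (Δ : AbstractSimplicialComplex V) :
    SimpleGraph V where
  Adj u v := u ≠ v ∧ ({u, v} : Finset V) ∈ Δ
  symm := ⟨fun u v h => ⟨h.1.symm, by rw [Finset.pair_comm]; exact h.2⟩⟩
  loopless := ⟨fun _ h => h.1 rfl⟩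

/-- The clique complex of a graph: its faces are the nonempty finite cliques. -/
def cliqueComplex {V : Type*} (G : SimpleGraph V) : AbstractSimplicialComplex V where
  faces := {s | s.Nonempty ∧ G.IsClique (s : Set V)}
  isRelLowerSet_faces := by
    intro s hs
    exact ⟨hs.1, fun t hts ht => ⟨ht, hs.2.subset (Finset.coe_subset.mpr hts)⟩⟩
  singleton_mem v := ⟨Finset.singleton_nonempty v, by simp⟩

/-- A minimal cycle: a cycle of length `> 3` without a chord. -/
def IsMinimalCycle {V : Type*} {G : SimpleGraph V} {v : V} (c : G.Walk v v) : Prop :=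
  c.IsCycle ∧ 3 < c.length ∧ c.IsChordless

/-- A graph is chordal if every cycle of length `> 3` has a chord. -/
def IsChordal {V : Type*} (G : SimpleGraph V) : Prop :=
  ∀ (v : V) (c : G.Walk v v), c.IsCycle → 3 < c.length → ∃ e, c.IsChord e

/-- A minimal graded free resolution
`⋯ → F_2 → F_1 → F_0 → I → 0` of an ideal `I` of `S = k[x_v : v ∈ V]` (standard grading), written
in homogeneous bases: `F_t = ⨁_b S(-deg t b)` with `b` running over `Fin (rank t)`. -/
structure MinimalGradedFreeResolution {k : Type*} [Field k] {V : Type*}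
    (I : Ideal (MvPolynomial V k)) where
  /-- the rank of `F_t` -/
  rank : ℕ → ℕ
  /-- the degrees of the basis elements of `F_t` -/
  deg : (t : ℕ) → Fin (rank t) → ℕ
  /-- the images in `I` of the basis elements of `F_0` -/
  gen : Fin (rank 0) → MvPolynomial V k
  /-- `φ t` is the matrix of the differential `F_{t+1} → F_t` -/
  φ : (t : ℕ) → Matrix (Fin (rank t)) (Fin (rank (t + 1))) (MvPolynomial V k)
  /-- `F_0 → I` preserves degrees -/
  gen_homogeneous : ∀ b, (gen b).IsHomogeneous (deg 0 b)
  /-- the differentials preserve degrees: the `(i, j)` entry is a form of degree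
  `deg (t + 1) j - deg t i`, and is zero if that number is negative -/
  φ_homogeneous : ∀ t i j, ∀ m ∈ (φ t i j).support, m.degree + deg t i = deg (t + 1) j
  /-- `F_0 → I` is onto -/
  span_gen : Ideal.span (Set.range gen) = I
  /-- exactness at `F_0` -/
  exact_zero : LinearMap.range (φ 0).mulVecLin =
    LinearMap.ker (Fintype.linearCombination (MvPolynomial V k) gen)
  /-- exactness at `F_{t+1}` -/
  exact_succ : ∀ t, LinearMap.range (φ (t + 1)).mulVecLin = LinearMap.ker (φ t).mulVecLin
  /-- minimality: the image of each differential lies in `𝔪 F_t`, `𝔪 = (x_v : v ∈ V)` -/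
  minimal : ∀ t i j, constantCoeff (φ t i j) = 0

/-- The condition `N_{2,p}` (for `1 ≤ p ≤ ∞`): `I` is generated by quadrics, and in the minimal
free resolution of `I` the matrices of `F_t → F_{t-1}`, `1 ≤ t ≤ p - 1`, consist of linear
forms.  Minimal resolutions are unique up to graded isomorphism, so it does not matter
which one is taken. -/
def SatisfiesN2 {k : Type*} [Field k] {V : Type*}
    (I : Ideal (MvPolynomial V k)) (p : ℕ∞) : Prop :=
  I = Ideal.span {f | f ∈ I ∧ f.IsHomogeneous 2} ∧
    ∃ F : MinimalGradedFreeResolution I, ∀ t : ℕ, ((t + 1 : ℕ) : ℕ∞) < p →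
      ∀ i j, (F.φ t i j).IsHomogeneous 1

/-- Castelnuovo-Mumford regularity: `I` is `m`-regular if in its minimal free resolution `F_t` is
generated in degrees `≤ t + m` for all `t`, i.e. `Tor_t(I, k)` lives in degrees `≤ t + m`. -/
def IsCMRegular {k : Type*} [Field k] {V : Type*}
    (I : Ideal (MvPolynomial V k)) (m : ℕ) : Prop :=
  ∃ F : MinimalGradedFreeResolution I, ∀ t b, F.deg t b ≤ t + m

end LinearSyzygies

/-! By minimality, the degrees of the basis of `F_t` are exactly those in which `Tor_t(I_Δ, k)` is
nonzero, and this Tor is the homology of the Koszul complex with coefficients in `I_Δ`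
(`MinimalGradedFreeResolution.koszulExact_iff`). The Koszul complex splits by multidegree. A
multidegree with an exponent `≥ 2` gives a cone, which is acyclic; the squarefree one with support
`W` gives the complex of those `τ ⊆ W` whose complement in `W` is a non-face. Complementation in `W`
turns its homology into the reduced cohomology of `Δ` restricted to `W` (Hochster's formula). With
`|W| = d = t + 1 + q`, the homology at `t` becomes cohomology at faces with `q` vertices, so degrees
`d > t + 2` correspond to `q ≥ 2`, that is, to positive dimension.

Generation by quadrics makes `Δ` the clique complex of its 1-skeleton, and a question on graphs
remains. If all minimal cycles are longer than `t + 3`, the relevant cohomology vanishes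
(`coboundaryExact_of_forall_isMinimalCycle`): on deleting a vertex `v`, a cocycle reduces to a
cocycle on the link of `v`, where `q` and the number of vertices both drop. At `q = 2` the
obstruction is one of connectivity: a shortest walk between two neighbours of `v` on which the link
cocycle differs would close up through `v` to a minimal cycle with too few vertices. Conversely, `Δ`
restricted to a minimal cycle of length `n` is a circle, so `Tor_{n-3}` is nonzero in degree `n`,
one above the linear degree `n - 1`.

Finally, linear matrices up to `p - 1` force `F_t` to live in degree `t + 2` for all `t < p`, which
excludes exactly the minimal cycles of length `< p + 3`; 2-regularity excludes all of them. -/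

namespace LinearSyzygies

/-! ### Contraction, exterior multiplication and the Koszul differential on functions of finite sets
-/

section Operators

variable {V : Type*} [Fintype V]

/-- The sign attached to an ordered pair of vertices, for a fixed enumeration of the vertices. -/
noncomputable def pairSign (u v : V) : ℤ :=
  if Fintype.equivFin V u < Fintype.equivFin V v then -1 else 1

/-- The sign of moving `v` past the elements of `τ`. -/
noncomputable def orderSign (v : V) (τ : Finset V) : ℤ := ∏ u ∈ τ, pairSign u v

lemma pairSign_mul_self (u v : V) : pairSign u v * pairSign u v = 1 := by
  unfold pairSign; split_ifs <;> norm_num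

lemma pairSign_swap {u v : V} (h : u ≠ v) : pairSign v u = -pairSign u v := by
  have : Fintype.equivFin V u ≠ Fintype.equivFin V v := fun e =>
    h ((Fintype.equivFin V).injective e)
  unfold pairSign
  rcases lt_or_gt_of_ne this with h1 | h1
  · rw [if_pos h1, if_neg h1.not_gt]; norm_num
  · rw [if_pos h1, if_neg h1.not_gt]

lemma orderSign_mul_self (v : V) (τ : Finset V) : orderSign v τ * orderSign v τ = 1 := by
  unfold orderSign
  rw [← Finset.prod_mul_distrib]
  exact Finset.prod_eq_one fun u _ => pairSign_mul_self u v

variable [DecidableEq V]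

lemma orderSign_insert {u v : V} {τ : Finset V} (h : u ∉ τ) :
    orderSign v (insert u τ) = pairSign u v * orderSign v τ := by
  unfold orderSign; rw [Finset.prod_insert h]

variable (R : Type*) [CommRing R] {M : Type*} [AddCommGroup M] [Module R M]

/-- Contraction of a cochain by a vertex. -/
noncomputable def contract (v : V) : Module.End R (Finset V → M) where
  toFun f τ := if v ∈ τ then 0 else orderSign v τ • f (insert v τ)
  map_add' f g := by funext τ; by_cases h : v ∈ τ <;> simp [h]
  map_smul' r f := by
    funext τ
    by_cases h : v ∈ τ
    · simp [h]
    · simp only [h, if_false, Pi.smul_apply, RingHom.id_apply]; rw [smul_comm]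

/-- Exterior multiplication of a cochain by a vertex. -/
noncomputable def wedge (v : V) : Module.End R (Finset V → M) where
  toFun f τ := if v ∈ τ then orderSign v (τ.erase v) • f (τ.erase v) else 0
  map_add' f g := by funext τ; by_cases h : v ∈ τ <;> simp [h]
  map_smul' r f := by
    funext τ
    by_cases h : v ∈ τ
    · simp only [h, if_true, Pi.smul_apply, RingHom.id_apply]; rw [smul_comm]
    · simp [h]

lemma contract_apply (v : V) (f : Finset V → M) (τ : Finset V) :
    contract R v f τ = if v ∈ τ then 0 else orderSign v τ • f (insert v τ) := rfl

lemma wedge_apply (v : V) (f : Finset V → M) (τ : Finset V) :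
    wedge R v f τ = if v ∈ τ then orderSign v (τ.erase v) • f (τ.erase v) else 0 := rfl

lemma contract_contract_self (v : V) (f : Finset V → M) : contract R v (contract R v f) = 0 := by
  funext τ
  simp [contract_apply]

lemma contract_contract {u v : V} (h : u ≠ v) (f : Finset V → M) :
    contract R u (contract R v f) = -contract R v (contract R u f) := by
  funext τ
  simp only [contract_apply, Pi.neg_apply]
  by_cases hu : u ∈ τ <;> by_cases hv : v ∈ τ <;>
    simp only [hu, hv, if_true, if_false, Finset.mem_insert, or_true, h, h.symm, or_false,
      smul_zero, neg_zero]
  rw [orderSign_insert hu, orderSign_insert hv, smul_smul, smul_smul, pairSign_swap h,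
    Finset.insert_comm, ← neg_smul]
  congr 1
  ring

lemma wedge_wedge_self (v : V) (f : Finset V → M) : wedge R v (wedge R v f) = 0 := by
  funext τ
  simp [wedge_apply]

lemma wedge_wedge {u v : V} (h : u ≠ v) (f : Finset V → M) :
    wedge R u (wedge R v f) = -wedge R v (wedge R u f) := by
  funext τ
  simp only [wedge_apply, Pi.neg_apply]
  by_cases hu : u ∈ τ <;> by_cases hv : v ∈ τ <;>
    simp only [hu, hv, if_true, if_false, Finset.mem_erase, h, h.symm, ne_eq, not_false_eq_true,
      and_self, and_false, smul_zero, neg_zero]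
  obtain ⟨ρ, hρu, hρv, rfl⟩ : ∃ ρ : Finset V, u ∉ ρ ∧ v ∉ ρ ∧ τ = insert u (insert v ρ) :=
    ⟨(τ.erase u).erase v, by simp, by simp, by
      rw [Finset.insert_erase (by simp [hv, h.symm]), Finset.insert_erase hu]⟩
  have e1 : (insert u (insert v ρ)).erase u = insert v ρ := by
    rw [Finset.erase_insert (by simp [h, hρu])]
  have e2 : (insert u (insert v ρ)).erase v = insert u ρ := by
    rw [Finset.insert_comm, Finset.erase_insert (by simp [h.symm, hρv])]
  rw [e1, e2, Finset.erase_insert hρv, Finset.erase_insert hρu, orderSign_insert hρu,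
    orderSign_insert hρv, smul_smul, smul_smul, pairSign_swap h, ← neg_smul]
  congr 1
  ring

/-- Together with `contract_wedge` these are the Clifford relations, the source of all the
homotopies below. -/
lemma contract_wedge_self (v : V) (f : Finset V → M) :
    contract R v (wedge R v f) + wedge R v (contract R v f) = f := by
  funext τ
  simp only [contract_apply, wedge_apply, Pi.add_apply]
  by_cases hv : v ∈ τ
  · simp [hv, smul_smul, orderSign_mul_self, Finset.insert_erase hv]
  · simp [hv, smul_smul, orderSign_mul_self, Finset.erase_insert hv]

lemma contract_wedge {u v : V} (h : u ≠ v) (f : Finset V → M) :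
    contract R u (wedge R v f) = -wedge R v (contract R u f) := by
  funext τ
  simp only [contract_apply, wedge_apply, Pi.neg_apply]
  by_cases hu : u ∈ τ <;> by_cases hv : v ∈ τ <;>
    simp only [hu, hv, if_true, if_false, Finset.mem_insert, Finset.mem_erase, h, h.symm, ne_eq,
      not_false_eq_true, and_self, and_false, smul_zero, neg_zero, or_true, or_false]
  obtain ⟨ρ, hρv, rfl⟩ : ∃ ρ : Finset V, v ∉ ρ ∧ τ = insert v ρ :=
    ⟨τ.erase v, by simp, (Finset.insert_erase hv).symm⟩
  have hρu : u ∉ ρ := fun h' => hu (Finset.mem_insert_of_mem h')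
  rw [Finset.insert_comm, Finset.erase_insert (by simp [h.symm, hρv]), Finset.erase_insert hρv,
    orderSign_insert hρu, orderSign_insert hρv, smul_smul, smul_smul, pairSign_swap h, ← neg_smul]
  congr 1
  linear_combination (-(orderSign u ρ * orderSign v ρ)) * pairSign_mul_self u v

variable {R}

/-- The Koszul differential of the elements `x v`. -/
noncomputable def koszulD (x : V → R) : Module.End R (Finset V → M) := ∑ v, x v • contract R v

lemma koszulD_apply (x : V → R) (f : Finset V → M) :
    koszulD x f = ∑ v, x v • contract R v f := by
  simp [koszulD, LinearMap.sum_apply]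

lemma koszulD_apply_apply (x : V → R) (f : Finset V → M) (τ : Finset V) :
    koszulD x f τ = ∑ v, x v • contract R v f τ := by
  simp [koszulD, LinearMap.sum_apply, Finset.sum_apply]

lemma sum_sum_eq_zero_of_antisymm {N : Type*} [AddCommGroup N] (F : V → V → N)
    (hd : ∀ v, F v v = 0) (h : ∀ u v, u ≠ v → F u v = -F v u) : ∑ u, ∑ v, F u v = 0 := by
  rw [← Finset.sum_product']
  refine Finset.sum_involution (fun p _ => p.swap) ?_ ?_ ?_ ?_
  · rintro ⟨u, v⟩ -
    by_cases e : u = v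
    · subst e; simp [hd]
    · simp [h u v e]
  · rintro ⟨u, v⟩ - hne heq
    obtain ⟨-, rfl⟩ : v = u ∧ u = v := by simpa using heq
    exact hne (hd _)
  · simp
  · simp

lemma koszulD_koszulD (x : V → R) (f : Finset V → M) : koszulD x (koszulD x f) = 0 := by
  rw [koszulD_apply, koszulD_apply]
  simp only [map_sum, map_smul, Finset.smul_sum]
  refine sum_sum_eq_zero_of_antisymm _ (fun v => ?_) (fun u v h => ?_)
  · rw [contract_contract_self]; simp
  · rw [contract_contract R h, smul_smul, smul_smul, mul_comm]; simp

/-- Wedging with `v` is a null-homotopy of multiplication by `x v`. For `x = 1` it contracts every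
family of sets closed under inserting `v`. -/
lemma koszulD_wedge (x : V → R) (v : V) (f : Finset V → M) :
    koszulD x (wedge R v f) + wedge R v (koszulD x f) = x v • f := by
  rw [koszulD_apply, koszulD_apply]
  simp only [map_sum, map_smul]
  rw [← Finset.sum_add_distrib, Finset.sum_eq_single v]
  · rw [← smul_add, contract_wedge_self]
  · intro u _ h
    rw [contract_wedge R h]; simp
  · simp

/-- A morphism of modules commutes with the Koszul differentials. -/
lemma koszulD_map {N : Type*} [AddCommGroup N] [Module R N] (φ : M →ₗ[R] N) (x : V → R)
    (f : Finset V → M) : koszulD x (fun τ => φ (f τ)) = fun τ => φ (koszulD x f τ) := by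
  funext τ
  rw [koszulD_apply_apply, koszulD_apply_apply, map_sum]
  refine Finset.sum_congr rfl fun v _ => ?_
  rw [map_smul, contract_apply, contract_apply]
  split_ifs <;> simp

variable (R) in
/-- The simplicial coboundary. -/
noncomputable def cobd : Module.End R (Finset V → M) := ∑ v, wedge R v

lemma cobd_apply (f : Finset V → M) : cobd R f = ∑ v, wedge R v f := by
  simp [cobd, LinearMap.sum_apply]

lemma cobd_apply_apply (f : Finset V → M) (τ : Finset V) :
    cobd R f τ = ∑ v, wedge R v f τ := by
  simp [cobd, LinearMap.sum_apply, Finset.sum_apply]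

lemma cobd_cobd (f : Finset V → M) : cobd R (cobd R f) = 0 := by
  rw [cobd_apply, cobd_apply]
  simp only [map_sum]
  exact sum_sum_eq_zero_of_antisymm _ (fun v => wedge_wedge_self R v f)
    (fun u v h => wedge_wedge R h f)

lemma cobd_wedge (v : V) (f : Finset V → M) :
    cobd R (wedge R v f) = -wedge R v (cobd R f) := by
  rw [cobd_apply, cobd_apply, map_sum, ← Finset.sum_neg_distrib]
  refine Finset.sum_congr rfl fun u _ => ?_
  by_cases h : u = v
  · subst h; simp [wedge_wedge_self]
  · exact wedge_wedge R h f

lemma contract_cobd (v : V) (f : Finset V → M) :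
    contract R v (cobd R f) + cobd R (contract R v f) = f := by
  rw [cobd_apply, cobd_apply, map_sum, ← Finset.sum_add_distrib, Finset.sum_eq_single v]
  · rw [contract_wedge_self]
  · intro u _ h
    rw [contract_wedge R (Ne.symm h)]; simp
  · simp

/-- The coboundary at `σ` depends only on the values at the facets of `σ`. -/
lemma cobd_congr {f g : Finset V → M} {σ : Finset V}
    (h : ∀ v ∈ σ, f (σ.erase v) = g (σ.erase v)) : cobd R f σ = cobd R g σ := by
  rw [cobd_apply_apply, cobd_apply_apply]
  refine Finset.sum_congr rfl fun v _ => ?_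
  rw [wedge_apply, wedge_apply]
  split_ifs with hv
  · rw [h v hv]
  · rfl

lemma koszulD_congr {x : V → R} {f g : Finset V → M} {σ : Finset V}
    (h : ∀ v ∉ σ, f (insert v σ) = g (insert v σ)) : koszulD x f σ = koszulD x g σ := by
  rw [koszulD_apply_apply, koszulD_apply_apply]
  refine Finset.sum_congr rfl fun v _ => ?_
  rw [contract_apply, contract_apply]
  split_ifs with hv
  · rfl
  · rw [h v hv]

lemma koszulD_eq_zero {x : V → R} {f : Finset V → M} {σ : Finset V}
    (h : ∀ v ∉ σ, f (insert v σ) = 0) : koszulD x f σ = 0 := by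
  rw [koszulD_congr (g := 0) (by simpa using h), map_zero, Pi.zero_apply]

/-- The sign `∏ v ∈ σ, orderSign v (W \ v)` that makes complementation in `W` turn boundaries into
coboundaries. -/
noncomputable def complSign (W σ : Finset V) : ℤ := ∏ v ∈ σ, orderSign v (W.erase v)

lemma complSign_mul_self (W σ : Finset V) : complSign W σ * complSign W σ = 1 := by
  unfold complSign
  rw [← Finset.prod_mul_distrib]
  exact Finset.prod_eq_one fun u _ => orderSign_mul_self u _

/-- Complementation in `W` turns boundaries into coboundaries. -/
lemma cobd_compl {W : Finset V} {b g : Finset V → M} (hb : ∀ τ, b τ ≠ 0 → τ ⊆ W)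
    {σ : Finset V} (hσ : σ ⊆ W)
    (hg : ∀ v ∈ σ, g (σ.erase v) = complSign W (σ.erase v) • b (W \ σ.erase v)) :
    cobd R g σ = complSign W σ • koszulD (1 : V → R) b (W \ σ) := by
  rw [cobd_apply_apply, koszulD_apply_apply, Finset.smul_sum]
  refine Finset.sum_congr rfl fun v _ => ?_
  rw [Pi.one_apply, one_smul, wedge_apply, contract_apply]
  by_cases hv : v ∈ σ
  · rw [if_pos hv, if_neg (by simp [hv]), hg v hv, smul_smul, smul_smul]
    have e1 : W \ σ.erase v = insert v (W \ σ) := by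
      ext u; simp only [Finset.mem_sdiff, Finset.mem_erase, Finset.mem_insert]
      by_cases hu : u = v
      · subst hu; simp [hσ hv]
      · simp [hu]
    rw [e1]
    congr 1
    have e2 : complSign W σ = orderSign v (W.erase v) * complSign W (σ.erase v) := by
      unfold complSign; rw [Finset.mul_prod_erase σ (fun v => orderSign v (W.erase v)) hv]
    -- Since `v ∈ σ ⊆ W`, the set `W.erase v` is the disjoint union of `W \ σ` and `σ.erase v`.
    have e3 : orderSign v (W.erase v) = orderSign v (W \ σ) * orderSign v (σ.erase v) := by
      unfold orderSign
      rw [← Finset.prod_union]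
      · congr 1
        ext u
        simp only [Finset.mem_sdiff, Finset.mem_erase, Finset.mem_union]
        by_cases hu : u = v
        · subst hu; simp [hv]
        · have := @hσ u
          by_cases h1 : u ∈ σ
          · simp [hu, h1, this h1]
          · simp [hu, h1]
      · rw [Finset.disjoint_left]
        intro u hu hu'
        exact (Finset.mem_sdiff.1 hu).2 (Finset.mem_of_mem_erase hu')
    rw [e2, e3]
    have := orderSign_mul_self v (W \ σ)
    linear_combination (-(orderSign v (σ.erase v) * complSign W (σ.erase v))) * this
  -- A vertex outside `σ` contributes nothing to the right side either: it lies in `W \ σ`, or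
  -- outside `W`, where `b` vanishes.
  · rw [if_neg hv]
    split_ifs with h
    · simp
    · have : v ∉ W := fun h' => h (Finset.mem_sdiff.2 ⟨h', hv⟩)
      have : b (insert v (W \ σ)) = 0 := by
        by_contra h'
        exact this (hb _ h' (Finset.mem_insert_self _ _))
      rw [this]; simp

end Operators

/-! ### Cones and combinatorial Alexander duality -/

section Exactness

variable {V : Type*} [Fintype V] [DecidableEq V]

/-- Exactness in degree `t` (the number of vertices) of the chain complex with coefficients in `k`
of the family `P` of finite sets. -/
def BoundaryExact (k : Type*) [Field k] (P : Finset V → Prop) (t : ℕ) : Prop :=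
  ∀ c : Finset V → k, (∀ τ, c τ ≠ 0 → P τ ∧ τ.card = t) → koszulD (1 : V → k) c = 0 →
    ∃ b : Finset V → k, (∀ τ, b τ ≠ 0 → P τ) ∧ koszulD (1 : V → k) b = c

/-- Exactness in degree `q` (the number of vertices) of the cochain complex with coefficients in
`k` of the faces in `W` of the family `F`. -/
def CoboundaryExact (k : Type*) [Field k] (F : Finset V → Prop) (W : Finset V) (q : ℕ) : Prop :=
  ∀ g : Finset V → k, (∀ σ ⊆ W, F σ → σ.card = q + 1 → cobd k g σ = 0) →
    ∃ f : Finset V → k, ∀ σ ⊆ W, F σ → σ.card = q → cobd k f σ = g σ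

variable {k : Type*} [Field k]

/-- The chain complex of a cone with apex `v` is exact. -/
lemma exists_koszulD_eq_of_cone {P : Finset V → Prop} (v : V) (hP : ∀ τ, P τ → P (insert v τ))
    (c : Finset V → k) (hc : ∀ τ, c τ ≠ 0 → P τ) (h : koszulD (1 : V → k) c = 0) :
    ∃ b : Finset V → k, (∀ τ, b τ ≠ 0 → P τ) ∧ koszulD (1 : V → k) b = c := by
  refine ⟨wedge k v c, fun τ hτ => ?_, ?_⟩
  · rw [wedge_apply] at hτ
    split_ifs at hτ with hv
    · have : c (τ.erase v) ≠ 0 := fun h => hτ (by rw [h, smul_zero])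
      simpa [Finset.insert_erase hv] using hP _ (hc _ this)
    · exact absurd rfl hτ
  · have := koszulD_wedge (1 : V → k) v c
    simpa [h] using this

lemma boundaryExact_of_cone {P : Finset V → Prop} (v : V) (hP : ∀ τ, P τ → P (insert v τ))
    (t : ℕ) : BoundaryExact k P t :=
  fun c hc h => exists_koszulD_eq_of_cone v hP c (fun τ hτ => (hc τ hτ).1) h

lemma exists_koszulD_eq_of_subset {W : Finset V} (hW : W.Nonempty) (c : Finset V → k)
    (hc : ∀ τ, c τ ≠ 0 → τ ⊆ W) (h : koszulD (1 : V → k) c = 0) :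
    ∃ b : Finset V → k, (∀ τ, b τ ≠ 0 → τ ⊆ W) ∧ koszulD (1 : V → k) b = c := by
  obtain ⟨v, hv⟩ := hW
  exact exists_koszulD_eq_of_cone (P := fun τ => τ ⊆ W) v
    (fun τ hτ => Finset.insert_subset hv hτ) c hc h

/-- Combinatorial Alexander duality. -/
lemma boundaryExact_of_coboundaryExact {F : Finset V → Prop} {W : Finset V} (hW : W.Nonempty)
    {t q : ℕ} (hcard : t + 1 + q = W.card)
    (h : CoboundaryExact k F W q) :
    BoundaryExact k (fun τ => τ ⊆ W ∧ ¬ F (W \ τ)) t := by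
  intro c hc hDc
  -- The full simplex on `W` is acyclic, so `c` bounds there; the preimage must be corrected on the
  -- sets whose complement is a face.
  obtain ⟨b₀, hb₀, hDb₀⟩ := exists_koszulD_eq_of_subset hW c (fun τ hτ => (hc τ hτ).1.1) hDc
  have hcsub : ∀ {τ}, τ ⊆ W → (W \ τ).card + τ.card = W.card := fun h =>
    Finset.card_sdiff_add_card_eq_card h
  set b : Finset V → k := fun τ => if τ.card = t + 1 then b₀ τ else 0 with hb
  have hbW : ∀ τ, b τ ≠ 0 → τ ⊆ W := fun τ hτ => by
    by_cases ht : τ.card = t + 1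
    · exact hb₀ τ (by simpa [hb, ht] using hτ)
    · simp [hb, ht] at hτ
  have hDb : koszulD (1 : V → k) b = c := by
    funext τ
    by_cases ht : τ.card = t
    · rw [← hDb₀]
      refine koszulD_congr fun v hv => ?_
      simp [hb, Finset.card_insert_of_notMem hv, ht]
    · rw [koszulD_eq_zero]
      · by_contra h'
        exact ht (hc τ (Ne.symm h')).2
      · intro v hv
        simp [hb, Finset.card_insert_of_notMem hv, ht]
  -- Transported to complements, `b` is a cocycle on the faces, because its boundary `c` vanishes on
  -- complements of faces.
  obtain ⟨f, hf⟩ := h (fun σ => complSign W σ • b (W \ σ)) (fun σ hσ hFσ hσc => by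
    rw [cobd_compl (W := W) (b := b) hbW hσ (fun _ _ => rfl), hDb]
    by_contra h'
    have : c (W \ σ) ≠ 0 := fun h'' => h' (by rw [h'', smul_zero])
    refine (hc _ this).1.2 ?_
    rwa [Finset.sdiff_sdiff_eq_self hσ])
  -- The primitive `f` transported back: the boundary of `b'` agrees with `b` on sets of size `t +
  -- 1` with face complement, so `b - koszulD 1 b'` vanishes there.
  set b' : Finset V → k := fun τ => if τ ⊆ W ∧ τ.card = t + 2 then complSign W (W \ τ) • f (W \ τ)
    else 0 with hb'
  have hb'W : ∀ τ, b' τ ≠ 0 → τ ⊆ W := fun τ hτ => by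
    by_contra h'
    exact hτ (by simp [hb', h'])
  refine ⟨b - koszulD (1 : V → k) b', fun τ hτ => ?_, by
    rw [map_sub, koszulD_koszulD, sub_zero, hDb]⟩
  have hτW : τ ⊆ W := by
    by_contra h'
    have h1 : b τ = 0 := by
      by_contra h''
      exact h' (hbW τ h'')
    refine hτ ?_
    rw [Pi.sub_apply, h1, koszulD_eq_zero, sub_zero]
    intro v _
    by_contra h''
    exact h' ((Finset.subset_insert v τ).trans (hb'W _ h''))
  refine ⟨hτW, fun hFτ => hτ ?_⟩
  by_cases hτc : τ.card = t + 1
  · have hσ : W \ τ ⊆ W := Finset.sdiff_subset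
    have hq : (W \ τ).card = q := by have := hcsub hτW; omega
    have e := hf _ hσ hFτ hq
    rw [cobd_compl (W := W) (b := b') hb'W hσ, Finset.sdiff_sdiff_eq_self hτW] at e
    · have e' := congrArg (fun x => complSign W (W \ τ) • x) e
      simp only [smul_smul, complSign_mul_self, one_smul] at e'
      rw [Pi.sub_apply, e', sub_self]
    · intro v hv
      have hs : (W \ τ).erase v ⊆ W := (Finset.erase_subset _ _).trans hσ
      have hvτ : v ∉ τ := (Finset.mem_sdiff.1 hv).2
      have hc' : (W \ (W \ τ).erase v).card = t + 2 := by
        have := hcsub hs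
        rw [Finset.card_erase_of_mem hv] at this
        have := Finset.card_pos.2 ⟨v, hv⟩
        omega
      simp only [hb', hc', Finset.sdiff_subset, and_self, if_true, Finset.sdiff_sdiff_eq_self hs,
        smul_smul, complSign_mul_self, one_smul]
  · rw [Pi.sub_apply, koszulD_eq_zero]
    · simp [hb, hτc]
    · intro v hv
      simp [hb', Finset.card_insert_of_notMem hv, hτc]

/-- A cocycle on the faces, extended by zero and transported to complements, is a chain `b` whose
boundary lives on complements of non-faces. Exactness there replaces `b` by a cycle of the full
simplex; a preimage of that cycle, transported back, is the required cochain. Heredity of `F`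
ensures that every facet of a face keeps its value under the extension. -/
lemma coboundaryExact_of_boundaryExact {F : Finset V → Prop} {W : Finset V} (hW : W.Nonempty)
    (hF : ∀ σ, F σ → ∀ v ∈ σ, F (σ.erase v)) {t q : ℕ} (hcard : t + 1 + q = W.card)
    (h : BoundaryExact k (fun τ => τ ⊆ W ∧ ¬ F (W \ τ)) t) :
    CoboundaryExact k F W q := by
  classical
  intro g hg
  have hcsub : ∀ {τ}, τ ⊆ W → (W \ τ).card + τ.card = W.card := fun h =>
    Finset.card_sdiff_add_card_eq_card h
  set b : Finset V → k := fun τ => if τ ⊆ W ∧ τ.card = t + 1 ∧ F (W \ τ) then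
    complSign W (W \ τ) • g (W \ τ) else 0 with hb
  have hbW : ∀ τ, b τ ≠ 0 → τ ⊆ W := fun τ hτ => by
    by_contra h'
    exact hτ (by simp [hb, h'])
  obtain ⟨b₂, hb₂, hDb₂⟩ := h (koszulD 1 b) (fun τ hτ => by
    have hτW : τ ⊆ W := by
      by_contra h'
      refine hτ (koszulD_eq_zero fun v _ => ?_)
      by_contra h''
      exact h' ((Finset.subset_insert v τ).trans (hbW _ h''))
    have hτc : τ.card = t := by
      by_contra h'
      refine hτ (koszulD_eq_zero fun v hv => ?_)
      simp [hb, Finset.card_insert_of_notMem hv, h']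
    refine ⟨⟨hτW, fun hFτ => hτ ?_⟩, hτc⟩
    have hσ : W \ τ ⊆ W := Finset.sdiff_subset
    have e := cobd_compl (R := k) (W := W) (b := b) (g := g) hbW hσ (fun v hv => by
      have hs : (W \ τ).erase v ⊆ W := (Finset.erase_subset _ _).trans hσ
      have hc' : (W \ (W \ τ).erase v).card = t + 1 := by
        have := hcsub hs
        have := hcsub hτW
        rw [Finset.card_erase_of_mem hv] at *
        have := Finset.card_pos.2 ⟨v, hv⟩
        omega
      simp only [hb, hc', Finset.sdiff_subset, Finset.sdiff_sdiff_eq_self hs, hF _ hFτ v hv,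
        and_self, if_true, smul_smul, complSign_mul_self, one_smul])
    rw [hg _ hσ hFτ (by have := hcsub hτW; omega), Finset.sdiff_sdiff_eq_self hτW] at e
    have e' := congrArg (fun x => complSign W (W \ τ) • x) e.symm
    simpa only [smul_smul, complSign_mul_self, one_smul, smul_zero] using e')
    (koszulD_koszulD _ _)
  -- `b - b₂` is a cycle of the full simplex on `W` and still agrees with `b` on complements of
  -- faces.
  obtain ⟨b₃, hb₃, hDb₃⟩ := exists_koszulD_eq_of_subset (k := k) hW (b - b₂) (fun τ hτ => by
    by_contra h'
    refine hτ ?_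
    have h1 : b τ = 0 := by
      by_contra h''; exact h' (hbW τ h'')
    have h2 : b₂ τ = 0 := by
      by_contra h''; exact h' (hb₂ τ h'').1
    simp [h1, h2]) (by rw [map_sub, hDb₂, sub_self])
  refine ⟨fun σ => complSign W σ • b₃ (W \ σ), fun σ hσ hFσ hσc => ?_⟩
  rw [cobd_compl (W := W) (b := b₃) hb₃ hσ (fun _ _ => rfl), hDb₃]
  have h2 : b₂ (W \ σ) = 0 := by
    by_contra h'
    have := (hb₂ _ h').2
    rw [Finset.sdiff_sdiff_eq_self hσ] at this
    exact this hFσ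
  have hc' : (W \ σ).card = t + 1 := by have := hcsub hσ; omega
  simp only [Pi.sub_apply, h2, sub_zero, hb, hc', Finset.sdiff_subset,
    Finset.sdiff_sdiff_eq_self hσ, hFσ, and_self, if_true, smul_smul, complSign_mul_self, one_smul]

end Exactness

/-! ### Cohomology of clique complexes and minimal cycles -/

section Cliques

variable {V : Type*} [Fintype V] [DecidableEq V] {G : SimpleGraph V}

omit [Fintype V] in
/-- A function that agrees at adjacent neighbours of `v` in `U` agrees at neighbours of `v` that
are connected in `U`, unless `U ∪ {v}` contains a minimal cycle. -/
lemma eq_of_walk_of_forall_isMinimalCycle {β : Type*} {v : V} {U : Finset V} (hv : v ∉ U)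
    (h : V → β) (hadj : ∀ a ∈ U, ∀ b ∈ U, G.Adj v a → G.Adj v b → G.Adj a b → h a = h b)
    (hcyc : ∀ (u : V) (c : G.Walk u u), IsMinimalCycle c → U.card + 1 < c.length)
    {a b : V} (p : G.Walk a b) (hp : ∀ x ∈ p.support, x ∈ U) (ha : G.Adj v a) (hb : G.Adj v b) :
    h a = h b := by
  induction hn : p.length using Nat.strong_induction_on generalizing a b with
  | _ n ih =>
    by_contra hab
    have key : ∀ {x y : V} (q : G.Walk x y), (∀ z ∈ q.support, z ∈ U) → G.Adj v x → G.Adj v y →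
        q.length < n → h x = h y := fun q hq hx hy hlt => ih _ hlt q hq hx hy rfl
    -- A counterexample of least length is a path: otherwise its bypass is shorter and the induction
    -- hypothesis applies.
    obtain ⟨q, hqpath, hqU, hqn⟩ : ∃ q : G.Walk a b, q.IsPath ∧ (∀ z ∈ q.support, z ∈ U) ∧
        q.length = n := by
      refine ⟨p.bypass, p.bypass_isPath, fun z hz => hp z (p.support_bypass_subset_support hz), ?_⟩
      by_contra hne
      have := p.length_bypass_le_length
      exact hab (key p.bypass (fun z hz => hp z (p.support_bypass_subset_support hz)) ha hb
        (by omega))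
    have hne : a ≠ b := fun e => hab (by rw [e])
    have hvq : v ∉ q.support := fun h' => hv (hqU v h')
    -- An interior neighbour of `v` would cut `q` into two shorter walks between neighbours of `v`.
    have hint : ∀ x ∈ q.support, G.Adj v x → x = a ∨ x = b := by
      intro x hx hvx
      by_contra! hx'
      refine hab ((key (q.takeUntil x hx)
        (fun z hz => hqU z (q.support_takeUntil_subset_support hx hz)) ha hvx ?_).trans
        (key (q.dropUntil x hx)
          (fun z hz => hqU z (q.support_dropUntil_subset_support hx hz)) hvx hb ?_))
      · rw [← hqn]; exact q.length_takeUntil_lt_length hx hx'.2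
      · rw [← hqn]; exact q.length_dropUntil_lt_length hx hx'.1
    -- A chord of `q` would give a shortcut.
    have hshort : ∀ i j : ℕ, i < j → j ≤ q.length → G.Adj (q.getVert i) (q.getVert j) →
        j = i + 1 := by
      intro i j hij hj hadj'
      by_contra hne'
      refine hab (key ((q.take i).append (SimpleGraph.Walk.cons hadj' (q.drop j))) ?_ ha hb ?_)
      · intro z hz
        rw [SimpleGraph.Walk.mem_support_append_iff, SimpleGraph.Walk.support_cons,
          List.mem_cons] at hz
        rcases hz with hz | rfl | hz
        · exact hqU z (q.isSubwalk_take i |>.support_subset hz)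
        · exact hqU _ (q.getVert_mem_support i)
        · exact hqU z (q.isSubwalk_drop j |>.support_subset hz)
      · rw [SimpleGraph.Walk.length_append, SimpleGraph.Walk.length_cons,
          SimpleGraph.Walk.take_length, SimpleGraph.Walk.drop_length]
        omega
    have hlen : 2 ≤ q.length := by
      by_contra! hlt
      have h1 : q.length = 1 := by
        have : q.length ≠ 0 := fun h0 => hne (q.eq_of_length_eq_zero h0)
        omega
      exact hab (hadj a (hqU a q.start_mem_support) b (hqU b q.end_mem_support) ha hb
        (q.adj_of_length_eq_one h1))
    -- The path closed up through `v` is a chordless cycle; it has length `q.length + 2 ≥ 4`.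
    set c : G.Walk v v := SimpleGraph.Walk.cons ha (q.concat hb.symm) with hc
    have hclen : c.length = q.length + 2 := by
      simp [hc, SimpleGraph.Walk.length_concat]
    have hmin : IsMinimalCycle c := by
      refine ⟨?_, by omega, ?_⟩
      · rw [hc, SimpleGraph.Walk.cons_isCycle_iff]
        refine ⟨hqpath.concat hvq _, ?_⟩
        rw [SimpleGraph.Walk.edges_concat, List.concat_eq_append, List.mem_append]
        rintro (h' | h')
        · exact hvq (q.fst_mem_support_of_mem_edges h')
        · rw [List.mem_singleton, Sym2.eq_swap, Sym2.congr_left] at h'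
          exact hne h'
      · have hedge : ∀ x ∈ q.support, G.Adj v x → s(v, x) ∈ c.edges := by
          intro x hx hvx
          rcases hint x hx hvx with rfl | rfl
          · simp [hc]
          · simp [hc, SimpleGraph.Walk.edges_concat, Sym2.eq_swap]
        have hmem : ∀ x, x ∈ c.support → x = v ∨ x ∈ q.support := by
          intro x hx
          simp only [hc, SimpleGraph.Walk.support_cons, SimpleGraph.Walk.support_concat,
            List.mem_cons, List.mem_append, List.not_mem_nil, or_false] at hx
          tauto
        have hidx : ∀ i j : ℕ, i < j → j ≤ q.length → G.Adj (q.getVert i) (q.getVert j) →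
            s(q.getVert i, q.getVert j) ∈ c.edges := by
          intro i j hij hj hadj'
          obtain rfl := hshort i j hij hj hadj'
          have : s(q.getVert i, q.getVert (i + 1)) ∈ q.edges := by
            rw [← SimpleGraph.Walk.adj_toSubgraph_iff_mem_edges]
            exact q.toSubgraph_adj_getVert (by omega)
          simp [hc, SimpleGraph.Walk.edges_concat, this]
        rw [SimpleGraph.Walk.isChordless_iff_forall_mem_edges]
        intro x y hx hy hxy
        rcases hmem x hx with rfl | hx'
        · rcases hmem y hy with rfl | hy'
          · exact absurd hxy (G.loopless.irrefl _)
          · exact hedge y hy' hxy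
        · rcases hmem y hy with rfl | hy'
          · rw [Sym2.eq_swap]; exact hedge x hx' hxy.symm
          · obtain ⟨i, rfl, hi⟩ := SimpleGraph.Walk.mem_support_iff_exists_getVert.1 hx'
            obtain ⟨j, rfl, hj⟩ := SimpleGraph.Walk.mem_support_iff_exists_getVert.1 hy'
            rcases lt_trichotomy i j with hij | rfl | hij
            · exact hidx i j hij hj hxy
            · exact absurd hxy (G.loopless.irrefl _)
            · rw [Sym2.eq_swap]; exact hidx j i hij hi hxy.symm
    -- The `q.length + 1` distinct vertices of `q` lie in `U`, so the cycle has length at most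
    -- `U.card + 1`.
    have h1 := hcyc v c hmin
    have h2 : q.support.toFinset.card ≤ U.card :=
      Finset.card_le_card fun z hz => hqU z (by simpa using hz)
    rw [List.toFinset_card_of_nodup hqpath.support_nodup, SimpleGraph.Walk.length_support] at h2
    omega

variable {k : Type*} [Field k]

lemma cobd_pair {a b : V} (h : a ≠ b) (f : Finset V → k) :
    cobd k f {a, b} = pairSign b a • (f {b} - f {a}) := by
  have e1 : ({a, b} : Finset V).erase a = {b} := by
    rw [Finset.erase_insert (by simpa using h)]
  have e2 : ({a, b} : Finset V).erase b = {a} := by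
    rw [Finset.pair_comm, Finset.erase_insert (by simpa using h.symm)]
  rw [cobd_apply_apply, Fintype.sum_eq_add a b h]
  · simp only [wedge_apply, Finset.mem_insert, Finset.mem_singleton, true_or, or_true, if_true, e1,
      e2, orderSign, Finset.prod_singleton]
    rw [pairSign_swap h.symm, smul_sub, neg_smul, sub_eq_add_neg]
  · rintro x ⟨hxa, hxb⟩
    simp [wedge_apply, hxa, hxb]

omit [Fintype V] in
lemma isClique_erase {σ : Finset V} (h : G.IsClique (σ : Set V)) (v : V) :
    G.IsClique (σ.erase v : Finset V) :=
  h.subset (Finset.coe_subset.2 (Finset.erase_subset v σ))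

/-- The cohomology of the clique complex of a graph vanishes in positive dimension if there are
no short minimal cycles. -/
lemma coboundaryExact_of_forall_isMinimalCycle {L : ℕ}
    (hcyc : ∀ (u : V) (c : G.Walk u u), IsMinimalCycle c → L < c.length) (W : Finset V) :
    ∀ q, 2 ≤ q → W.card + 2 ≤ L + q →
      CoboundaryExact k (fun σ => G.IsClique (σ : Set V)) W q := by
  classical
  induction W using Finset.strongInduction with
  | H W ih =>
  intro q hq hWq g hg
  rcases W.eq_empty_or_nonempty with rfl | ⟨v, hv⟩
  · refine ⟨0, fun σ hσ _ hσc => ?_⟩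
    rw [Finset.subset_empty.1 hσ, Finset.card_empty] at hσc
    omega
  -- Solving on `W.erase v` first and subtracting leaves a cocycle `g'` that vanishes on the cliques
  -- avoiding `v`.
  obtain ⟨f₁, hf₁⟩ := ih (W.erase v) (Finset.erase_ssubset hv) q hq
    (by have := Finset.card_le_card (Finset.erase_subset v W); omega) g
    (fun σ hσ => hg σ (hσ.trans (Finset.erase_subset v W)))
  set f₀ : Finset V → k := fun σ => if v ∈ σ then 0 else f₁ σ with hf₀
  set g' : Finset V → k := g - cobd k f₀ with hg'
  have hg'0 : ∀ σ ⊆ W.erase v, G.IsClique (σ : Set V) → σ.card = q → g' σ = 0 := by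
    intro σ hσ hcl hσc
    have hvσ : v ∉ σ := fun h => by simpa using hσ h
    rw [hg', Pi.sub_apply, ← hf₁ σ hσ hcl hσc, sub_eq_zero]
    exact cobd_congr fun u _ => by
      simp [hf₀, hvσ]
  have hδg' : ∀ σ ⊆ W, G.IsClique (σ : Set V) → σ.card = q + 1 → cobd k g' σ = 0 := by
    intro σ hσ hcl hσc
    rw [hg', map_sub, cobd_cobd, sub_zero, hg σ hσ hcl hσc]
  suffices h : ∃ f : Finset V → k, ∀ σ ⊆ W, G.IsClique (σ : Set V) → σ.card = q →
      cobd k f σ = g' σ by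
    obtain ⟨f, hf⟩ := h
    refine ⟨f + f₀, fun σ hσ hcl hσc => ?_⟩
    rw [map_add, Pi.add_apply, hf σ hσ hcl hσc, hg', Pi.sub_apply, sub_add_cancel]
  -- The cliques in `N` form the link of `v`; there the contraction of `g'` by `v` is a cocycle one
  -- dimension lower.
  set N : Finset V := (W.erase v).filter fun u => G.Adj v u with hN
  have hNW : N ⊆ W.erase v := Finset.filter_subset _ _
  have hins : ∀ ρ : Finset V, ρ ⊆ N → G.IsClique (ρ : Set V) →
      G.IsClique ((insert v ρ : Finset V) : Set V) := by
    intro ρ hρ hcl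
    rw [Finset.coe_insert, SimpleGraph.isClique_insert]
    exact ⟨hcl, fun u hu _ => (Finset.mem_filter.1 (hρ hu)).2⟩
  have hδh : ∀ ρ ⊆ N, G.IsClique (ρ : Set V) → ρ.card = q → cobd k (contract k v g') ρ = 0 := by
    intro ρ hρ hcl hρc
    have hvρ : v ∉ ρ := fun h => by simpa using hNW (hρ h)
    have e := congrFun (contract_cobd (R := k) v g') ρ
    rw [Pi.add_apply, hg'0 ρ (hρ.trans hNW) hcl hρc, contract_apply, if_neg hvρ,
      hδg' _ (Finset.insert_subset hv ((hρ.trans hNW).trans (Finset.erase_subset v W)))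
        (hins ρ hρ hcl) (by rw [Finset.card_insert_of_notMem hvρ, hρc]), smul_zero, zero_add] at e
    exact e
  have hsplit : ∀ σ ⊆ W, G.IsClique (σ : Set V) → v ∈ σ → σ.erase v ⊆ N := by
    intro σ hσ hcl hvσ u hu
    rw [Finset.mem_erase] at hu
    exact Finset.mem_filter.2 ⟨Finset.mem_erase.2 ⟨hu.1, hσ hu.2⟩, hcl hvσ hu.2 hu.1.symm⟩
  have hcontr : ∀ σ, v ∈ σ → orderSign v (σ.erase v) • contract k v g' (σ.erase v) = g' σ := by
    intro σ hvσ
    rw [contract_apply, if_neg (Finset.notMem_erase v σ), smul_smul, orderSign_mul_self, one_smul,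
      Finset.insert_erase hvσ]
  -- For `q = 2` the link cocycle is a function on the neighbours of `v`, constant along edges. It
  -- need not be a constant, since the link may be disconnected, but it extends to a function on
  -- `W.erase v` that is constant along edges.
  by_cases hq2 : q = 2
  · subst hq2
    set h : V → k := fun a => contract k v g' {a} with hh
    have hadj : ∀ a ∈ W.erase v, ∀ b ∈ W.erase v, G.Adj v a → G.Adj v b → G.Adj a b →
        h a = h b := by
      intro a ha b hb hva hvb hab
      have e := hδh {a, b} (by
        intro x hx
        rw [Finset.mem_insert, Finset.mem_singleton] at hx
        rcases hx with rfl | rfl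
        · exact Finset.mem_filter.2 ⟨ha, hva⟩
        · exact Finset.mem_filter.2 ⟨hb, hvb⟩) (by
        rw [Finset.coe_insert, Finset.coe_singleton, SimpleGraph.isClique_pair]
        exact fun _ => hab) (Finset.card_pair hab.ne)
      rw [cobd_pair hab.ne] at e
      have e' := congrArg (fun x => pairSign b a • x) e
      simp only [smul_smul, pairSign_mul_self, one_smul, smul_zero] at e'
      exact (sub_eq_zero.1 e').symm
    have hconn := fun {a b : V} (p : G.Walk a b) =>
      eq_of_walk_of_forall_isMinimalCycle (Finset.notMem_erase v W) h hadj
      (fun u c hc => by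
        have := hcyc u c hc
        rw [Finset.card_erase_of_mem hv]
        have := Finset.card_pos.2 ⟨v, hv⟩
        omega) p
    -- The value of `h` at any neighbour of `v` reachable inside `W.erase v`; components without
    -- such a neighbour get `0`.
    set F : V → k := fun u => if H : ∃ a, G.Adj v a ∧ ∃ p : G.Walk u a, ∀ x ∈ p.support,
      x ∈ W.erase v then h H.choose else 0 with hF
    have hF1 : ∀ {u a : V} (p : G.Walk u a), (∀ x ∈ p.support, x ∈ W.erase v) → G.Adj v a →
        F u = h a := by
      intro u a p hp hva
      have H : ∃ a, G.Adj v a ∧ ∃ p : G.Walk u a, ∀ x ∈ p.support, x ∈ W.erase v :=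
        ⟨a, hva, p, hp⟩
      obtain ⟨hva', p', hp'⟩ := H.choose_spec
      rw [hF]
      simp only [dif_pos H]
      refine hconn (p'.reverse.append p) (fun x hx => ?_) hva' hva
      rw [SimpleGraph.Walk.mem_support_append_iff, SimpleGraph.Walk.support_reverse,
        List.mem_reverse] at hx
      exact hx.elim (hp' x) (hp x)
    have hF2 : ∀ a ∈ W.erase v, ∀ b ∈ W.erase v, G.Adj a b → F a = F b := by
      intro a ha b hb hab
      by_cases H : ∃ c, G.Adj v c ∧ ∃ p : G.Walk a c, ∀ x ∈ p.support, x ∈ W.erase v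
      · obtain ⟨c, hvc, p, hp⟩ := H
        rw [hF1 p hp hvc, hF1 (SimpleGraph.Walk.cons hab.symm p) _ hvc]
        intro x hx
        rw [SimpleGraph.Walk.support_cons, List.mem_cons] at hx
        exact hx.elim (fun e => e ▸ hb) (hp x)
      · have H' : ¬ ∃ c, G.Adj v c ∧ ∃ p : G.Walk b c, ∀ x ∈ p.support, x ∈ W.erase v := by
          rintro ⟨c, hvc, p, hp⟩
          refine H ⟨c, hvc, SimpleGraph.Walk.cons hab p, fun x hx => ?_⟩
          rw [SimpleGraph.Walk.support_cons, List.mem_cons] at hx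
          exact hx.elim (fun e => e ▸ ha) (hp x)
        simp only [hF, dif_neg H, dif_neg H']
    -- Only the values on singletons matter: `F u` at `u ≠ v`, and `0` at `v`.
    refine ⟨fun σ => ∑ u ∈ σ, if u = v then 0 else F u, fun σ hσ hcl hσc => ?_⟩
    have hvb : ∀ b ∈ W.erase v, G.Adj v b →
        cobd k (fun σ : Finset V => ∑ u ∈ σ, if u = v then 0 else F u) {v, b} = g' {v, b} := by
      intro b hb hvb
      have e := hF1 (SimpleGraph.Walk.nil' b) (by simpa using hb) hvb
      rw [cobd_pair hvb.ne]
      simp only [Finset.sum_singleton, if_true, if_neg hvb.ne', sub_zero]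
      rw [e, hh]
      simp only [contract_apply, Finset.mem_singleton, if_neg hvb.ne, orderSign,
        Finset.prod_singleton, smul_smul, pairSign_mul_self, one_smul]
    obtain ⟨a, b, hab, rfl⟩ := Finset.card_eq_two.1 hσc
    rw [Finset.coe_insert, Finset.coe_singleton, SimpleGraph.isClique_pair] at hcl
    have ha : a ∈ W := hσ (by simp)
    have hb : b ∈ W := hσ (by simp)
    by_cases hav : a = v
    · subst hav
      exact hvb b (Finset.mem_erase.2 ⟨hab.symm, hb⟩) (hcl hab)
    by_cases hbv : b = v
    · subst hbv
      rw [Finset.pair_comm]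
      exact hvb a (Finset.mem_erase.2 ⟨hab, ha⟩) (hcl hab).symm
    have ha' : a ∈ W.erase v := Finset.mem_erase.2 ⟨hav, ha⟩
    have hb' : b ∈ W.erase v := Finset.mem_erase.2 ⟨hbv, hb⟩
    rw [cobd_pair hab]
    simp only [Finset.sum_singleton, if_neg hav, if_neg hbv]
    rw [hF2 a ha' b hb' (hcl hab), sub_self, smul_zero, hg'0 _ _ _ hσc]
    · intro x hx
      rw [Finset.mem_insert, Finset.mem_singleton] at hx
      exact hx.elim (fun e => e ▸ ha') (fun e => e ▸ hb')
    · rw [Finset.coe_insert, Finset.coe_singleton, SimpleGraph.isClique_pair]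
      exact hcl
  -- Passing to the link lowers `q` by one and the number of vertices by at least one, which
  -- preserves `W.card + 2 ≤ L + q`.
  · obtain ⟨f₂, hf₂⟩ := ih N (hNW.trans_ssubset (Finset.erase_ssubset hv)) (q - 1) (by omega)
      (by
        have := Finset.card_le_card hNW
        rw [Finset.card_erase_of_mem hv] at this
        have := Finset.card_pos.2 ⟨v, hv⟩
        omega) (contract k v g') (fun ρ hρ hcl hρc => hδh ρ hρ hcl (by omega))
    -- The sign cancels the one from anticommuting the coboundary with the wedge.
    refine ⟨-wedge k v f₂, fun σ hσ hcl hσc => ?_⟩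
    rw [map_neg, cobd_wedge, neg_neg, wedge_apply]
    split_ifs with hvσ
    · rw [hf₂ _ (hsplit σ hσ hcl hvσ) (isClique_erase hcl v)
        (by rw [Finset.card_erase_of_mem hvσ, hσc]), hcontr σ hvσ]
    · exact (hg'0 σ (fun u hu => Finset.mem_erase.2 ⟨fun e => hvσ (e ▸ hu), hσ hu⟩) hcl hσc).symm

omit [Fintype V] [DecidableEq V] in
/-- A cycle of length `> 3` does not contain a triangle. -/
lemma not_triangle_of_isCycle {v : V} {c : G.Walk v v} (hc : c.IsCycle) (hlen : 3 < c.length)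
    {x y z : V} (hxy : s(x, y) ∈ c.edges) (hyz : s(y, z) ∈ c.edges) (hxz : s(x, z) ∈ c.edges) :
    False := by
  have hidx : ∀ a ∈ c.support, ∃ i < c.length, c.getVert i = a := by
    intro a ha
    obtain ⟨i, rfl, hi⟩ := SimpleGraph.Walk.mem_support_iff_exists_getVert.1 ha
    rcases hi.lt_or_eq with hi | rfl
    · exact ⟨i, hi, rfl⟩
    · exact ⟨0, by omega, by rw [c.getVert_length, c.getVert_zero]⟩
  have hinj : ∀ i j, i < c.length → j < c.length → c.getVert i = c.getVert j → i = j :=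
    fun i j hi hj h => hc.getVert_injOn' (by simp; omega) (by simp; omega) h
  have hstep : ∀ i j m : ℕ, i < c.length → j < c.length → m < c.length →
      c.getVert m = c.getVert i → c.getVert (m + 1) = c.getVert j →
      j = i + 1 ∨ (j = 0 ∧ i + 1 = c.length) := by
    intro i j m hi hj hm h1 h2
    obtain rfl := hinj m i hm hi h1
    rcases Nat.lt_or_ge (m + 1) c.length with hlt | hge
    · exact Or.inl (hinj _ _ hlt hj h2).symm
    · have : m + 1 = c.length := by omega
      rw [this, c.getVert_length] at h2
      exact Or.inr ⟨(hinj _ _ (by omega) hj (c.getVert_zero.trans h2)).symm, this⟩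
  have hedge : ∀ i j, i < c.length → j < c.length →
      s(c.getVert i, c.getVert j) ∈ c.edges →
      j = i + 1 ∨ (j = 0 ∧ i + 1 = c.length) ∨ i = j + 1 ∨ (i = 0 ∧ j + 1 = c.length) := by
    -- Edges join cyclically consecutive indices; three distinct indices that are pairwise so force
    -- length `3`.
    intro i j hi hj h
    rw [← SimpleGraph.Walk.adj_toSubgraph_iff_mem_edges, SimpleGraph.Walk.toSubgraph_adj_iff] at h
    obtain ⟨m, hm, hmlt⟩ := h
    rcases Sym2.eq_iff.1 hm with ⟨h1, h2⟩ | ⟨h1, h2⟩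
    · have := hstep i j m hi hj hmlt h1 h2; tauto
    · have := hstep j i m hj hi hmlt h1 h2; tauto
  obtain ⟨i, hi, rfl⟩ := hidx x (c.fst_mem_support_of_mem_edges hxy)
  obtain ⟨j, hj, rfl⟩ := hidx y (c.snd_mem_support_of_mem_edges hxy)
  obtain ⟨l, hl, rfl⟩ := hidx z (c.snd_mem_support_of_mem_edges hyz)
  have h1 := hedge i j hi hj hxy
  have h2 := hedge j l hj hl hyz
  have h3 := hedge i l hi hl hxz
  omega

/-- The clique complex of a minimal cycle has nonzero cohomology in dimension one. -/
lemma not_coboundaryExact_of_isMinimalCycle {v : V} {c : G.Walk v v} (hc : IsMinimalCycle c) :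
    ¬ CoboundaryExact k (fun σ => G.IsClique (σ : Set V)) c.support.toFinset 2 := by
  classical
  obtain ⟨hcyc, hlen, hchord⟩ := hc
  intro hex
  rw [SimpleGraph.Walk.isChordless_iff_forall_mem_edges] at hchord
  cases c with
  | nil => simp at hlen
  | @cons _ w _ hvw p =>
  set c := SimpleGraph.Walk.cons hvw p with hcdef
  have hcyc' := (SimpleGraph.Walk.cons_isCycle_iff _ _).1 hcyc
  -- The indicator of the first edge is a cocycle for lack of triangles.
  obtain ⟨f, hf⟩ := hex (fun σ => if σ = {v, w} then 1 else 0) (fun σ hσ hcl hσc => by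
    exfalso
    obtain ⟨x, y, z, hxy, hxz, hyz, rfl⟩ := Finset.card_eq_three.1 hσc
    have hmem : ∀ a b, a ∈ ({x, y, z} : Finset V) → b ∈ ({x, y, z} : Finset V) → a ≠ b →
        s(a, b) ∈ c.edges := fun a b ha hb hab =>
      hchord (List.mem_toFinset.1 (hσ ha)) (List.mem_toFinset.1 (hσ hb)) (hcl ha hb hab)
    exact not_triangle_of_isCycle hcyc hlen (hmem x y (by simp) (by simp) hxy)
      (hmem y z (by simp) (by simp) hyz) (hmem x z (by simp) (by simp) hxz))
  have hpair : ∀ a b : V, s(a, b) ∈ c.edges → cobd k f {a, b} =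
      if ({a, b} : Finset V) = {v, w} then 1 else 0 := by
    intro a b hab
    refine hf {a, b} ?_ ?_ (Finset.card_pair (c.adj_of_mem_edges hab).ne)
    · intro x hx
      rw [Finset.mem_insert, Finset.mem_singleton] at hx
      rw [List.mem_toFinset]
      rcases hx with rfl | rfl
      · exact c.fst_mem_support_of_mem_edges hab
      · exact c.snd_mem_support_of_mem_edges hab
    · beta_reduce
      rw [Finset.coe_insert, Finset.coe_singleton, SimpleGraph.isClique_pair]
      exact fun _ => c.adj_of_mem_edges hab
  -- A primitive is constant along the rest of the cycle, which joins `w` back to `v`, although its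
  -- coboundary on `{v, w}` is `1`.
  have hconst : ∀ {a b : V} (q : G.Walk a b), q.edges ⊆ p.edges → f {a} = f {b} := by
    intro a b q
    induction q with
    | nil => exact fun _ => rfl
    | @cons x y z hxy q ih =>
      intro hq
      rw [SimpleGraph.Walk.edges_cons, List.cons_subset] at hq
      rw [← ih hq.2]
      have e := hpair x y (by
        rw [hcdef, SimpleGraph.Walk.edges_cons]; exact List.mem_cons_of_mem _ hq.1)
      rw [if_neg, cobd_pair hxy.ne] at e
      · have e' := congrArg (fun t => pairSign y x • t) e
        simp only [smul_smul, pairSign_mul_self, one_smul, smul_zero] at e'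
        exact (sub_eq_zero.1 e').symm
      · intro he
        refine hcyc'.2 ?_
        have : s(x, y) = s(v, w) := by
          rw [Sym2.eq_iff]
          have h1 : x ∈ ({v, w} : Finset V) := he ▸ by simp
          have h2 : y ∈ ({v, w} : Finset V) := he ▸ by simp
          have := hxy.ne
          simp only [Finset.mem_insert, Finset.mem_singleton] at h1 h2
          grind
        exact this ▸ hq.1
  have e := hpair v w (by simp [hcdef])
  rw [if_pos rfl, cobd_pair hvw.ne, hconst p (List.Subset.refl _), sub_self, smul_zero] at e
  exact zero_ne_one e

end Cliques

open MvPolynomial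

/-! ### Multigraded pieces of the Koszul complex -/

section Slices

variable {V : Type*} [DecidableEq V]

/-- The exponent vector of a squarefree monomial. -/
noncomputable def expo (τ : Finset V) : V →₀ ℕ := ∑ v ∈ τ, Finsupp.single v 1

lemma expo_apply (τ : Finset V) (u : V) : expo τ u = if u ∈ τ then 1 else 0 := by
  simp [expo, Finsupp.finsetSum_apply, Finsupp.single_apply]

lemma expo_insert {v : V} {τ : Finset V} (h : v ∉ τ) :
    expo (insert v τ) = Finsupp.single v 1 + expo τ := by
  rw [expo, Finset.sum_insert h, expo]

omit [DecidableEq V] in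
lemma degree_expo (τ : Finset V) : (expo τ).degree = τ.card := by
  simp [expo, map_sum]

lemma support_expo (τ : Finset V) : (expo τ).support = τ := by
  ext u; simp [expo_apply]

lemma expo_le_expo {σ τ : Finset V} : expo σ ≤ expo τ ↔ σ ⊆ τ := by
  constructor
  · intro h u hu
    have := h u
    rw [expo_apply, expo_apply, if_pos hu] at this
    by_contra h'
    simp [h'] at this
  · intro h u
    rw [expo_apply, expo_apply]
    by_cases hu : u ∈ σ
    · simp [hu, h hu]
    · simp [hu]

lemma expo_insert_le_iff {v : V} {τ : Finset V} (h : v ∉ τ) (α : V →₀ ℕ) :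
    expo (insert v τ) ≤ α ↔ expo τ ≤ α ∧ v ∈ (α - expo τ).support := by
  rw [Finsupp.mem_support_iff, Finsupp.tsub_apply, expo_apply τ v, if_neg h, tsub_zero]
  constructor
  · intro hle
    refine ⟨fun u => ?_, ?_⟩
    · have := hle u
      rw [expo_apply] at this ⊢
      by_cases hu : u ∈ τ <;> simp [hu] at this ⊢
      exact this
    · have := hle v
      rw [expo_apply] at this
      simp at this
      omega
  · rintro ⟨hle, hv⟩ u
    have := hle u
    rw [expo_apply] at this ⊢
    by_cases hu : u = v
    · subst hu; simp; omega
    · simpa [hu] using this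

omit [DecidableEq V] in
lemma prod_X_eq_monomial_expo {k : Type*} [Field k] (τ : Finset V) :
    (∏ v ∈ τ, X v : MvPolynomial V k) = monomial (expo τ) 1 := by
  rw [expo, monomial_sum_one]; rfl

variable {k : Type*} [Field k]

/-- The component of multidegree `α` of an element of the Koszul complex of the polynomial ring. -/
noncomputable def slice (α : V →₀ ℕ) (f : Finset V → MvPolynomial V k) : Finset V → k :=
  fun τ => if expo τ ≤ α then coeff (α - expo τ) (f τ) else 0

omit [DecidableEq V] in
lemma slice_ext {f g : Finset V → MvPolynomial V k} (h : ∀ α, slice α f = slice α g) : f = g := by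
  funext τ
  ext m
  have := congrFun (h (m + expo τ)) τ
  simpa [slice] using this

/-- Multiplication by `x_v` restores to the exponent what contraction by `v` removes from the set,
so `m + expo τ` is preserved and the coefficients become `1`. -/
lemma slice_koszulD [Fintype V] (α : V →₀ ℕ) (f : Finset V → MvPolynomial V k) :
    slice α (koszulD (X : V → MvPolynomial V k) f) = koszulD (1 : V → k) (slice α f) := by
  funext τ
  rw [koszulD_apply_apply]
  simp only [Pi.one_apply, one_smul, contract_apply]
  by_cases hτ : expo τ ≤ α
  · rw [slice, if_pos hτ, koszulD_apply_apply, coeff_sum]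
    refine Finset.sum_congr rfl fun v _ => ?_
    rw [contract_apply]
    by_cases hv : v ∈ τ
    · simp [hv]
    · rw [if_neg hv, if_neg hv, smul_eq_mul, coeff_X_mul', slice]
      have hiff := expo_insert_le_iff hv α
      by_cases hs : v ∈ (α - expo τ).support
      · rw [if_pos hs, if_pos (hiff.2 ⟨hτ, hs⟩), expo_insert hv, add_comm, tsub_add_eq_tsub_tsub]
        exact map_zsmul (Finsupp.lapply _ : _ →ₗ[k] k) _ _
      · rw [if_neg hs, if_neg (fun h => hs (hiff.1 h).2), smul_zero]
  · rw [slice, if_neg hτ]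
    refine (Finset.sum_eq_zero fun v _ => ?_).symm
    split_ifs with hv
    · rfl
    · rw [slice, if_neg (fun h => hτ ((expo_insert_le_iff hv α).1 h).1), smul_zero]

/-- The element of the Koszul complex with prescribed components. -/
noncomputable def ofSlices (A : Finset (V →₀ ℕ)) (b : (V →₀ ℕ) → Finset V → k) :
    Finset V → MvPolynomial V k :=
  fun τ => ∑ α ∈ A, monomial (α - expo τ) (b α τ)

lemma slice_ofSlices (A : Finset (V →₀ ℕ)) (b : (V →₀ ℕ) → Finset V → k)
    (hb : ∀ α τ, b α τ ≠ 0 → expo τ ≤ α) (α : V →₀ ℕ) :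
    slice α (ofSlices A b) = if α ∈ A then b α else 0 := by
  have hcoeff : ∀ τ, expo τ ≤ α → coeff (α - expo τ) (ofSlices A b τ) =
      if α ∈ A then b α τ else 0 := by
    intro τ hτ
    rw [ofSlices, coeff_sum, ← Finset.sum_ite_eq' A α (fun β => b β τ)]
    refine Finset.sum_congr rfl fun β _ => ?_
    rw [coeff_monomial]
    by_cases h0 : b β τ = 0
    · simp [h0]
    · have : β - expo τ = α - expo τ ↔ β = α := by
        refine ⟨fun h => ?_, fun h => by rw [h]⟩
        rw [← tsub_add_cancel_of_le (hb β τ h0), h, tsub_add_cancel_of_le hτ]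
      simp only [this]
  funext τ
  by_cases hτ : expo τ ≤ α
  · rw [slice, if_pos hτ, hcoeff τ hτ]
    split_ifs <;> rfl
  · rw [slice, if_neg hτ]
    split_ifs
    · by_contra h
      exact hτ (hb α τ (Ne.symm h))
    · rfl

variable [Fintype V]

/-- Only the finitely many multidegrees in `A` give nonzero slices, so preimages chosen slice by
slice assemble to polynomials. -/
lemma exists_koszulD_eq_of_slices {P : (V →₀ ℕ) → Finset V → Prop}
    (hP : ∀ α τ, P α τ → expo τ ≤ α) (f : Finset V → MvPolynomial V k)
    (h : ∀ α, slice α f ≠ 0 →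
      ∃ b : Finset V → k, (∀ τ, b τ ≠ 0 → P α τ) ∧ koszulD (1 : V → k) b = slice α f) :
    ∃ u : Finset V → MvPolynomial V k, koszulD (X : V → MvPolynomial V k) u = f ∧
      ∀ α τ, slice α u τ ≠ 0 → P α τ := by
  classical
  have h' : ∀ α, ∃ b : Finset V → k, (∀ τ, b τ ≠ 0 → P α τ) ∧
      koszulD (1 : V → k) b = slice α f := by
    intro α
    by_cases h0 : slice α f = 0
    · exact ⟨0, by simp, by rw [h0, map_zero]⟩
    · exact h α h0
  choose b hbP hb using h'
  set A : Finset (V →₀ ℕ) := Finset.univ.biUnion fun τ => (f τ).support.image (· + expo τ) with hA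
  have hnot : ∀ α ∉ A, slice α f = 0 := by
    intro α hα
    funext τ
    by_contra hne
    by_cases hτ : expo τ ≤ α
    · rw [slice, if_pos hτ] at hne
      refine hα (Finset.mem_biUnion.2 ⟨τ, Finset.mem_univ _, Finset.mem_image.2
        ⟨α - expo τ, mem_support_iff.2 hne, tsub_add_cancel_of_le hτ⟩⟩)
    · rw [slice, if_neg hτ] at hne
      exact hne rfl
  have hs := slice_ofSlices A b (fun α τ hne => hP α τ (hbP α τ hne))
  refine ⟨ofSlices A b, slice_ext fun α => ?_, fun α τ hne => ?_⟩
  · rw [slice_koszulD, hs]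
    split_ifs with hα
    · exact hb α
    · rw [map_zero, hnot α hα]
  · rw [hs] at hne
    split_ifs at hne with hα
    · exact hbP α τ hne
    · exact absurd rfl hne

/-- The Koszul complex of the variables is acyclic. -/
lemma exists_koszulD_X_eq (f : Finset V → MvPolynomial V k)
    (hf : koszulD (X : V → MvPolynomial V k) f = 0)
    (h0 : constantCoeff (f ∅) = 0) : ∃ u, koszulD (X : V → MvPolynomial V k) u = f := by
  suffices h : ∀ α, slice α f ≠ 0 → ∃ b : Finset V → k, (∀ τ, b τ ≠ 0 → expo τ ≤ α) ∧
      koszulD (1 : V → k) b = slice α f by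
    obtain ⟨u, hu, -⟩ := exists_koszulD_eq_of_slices (P := fun α τ => expo τ ≤ α)
      (fun _ _ h => h) f h
    exact ⟨u, hu⟩
  intro α hα
  -- In multidegree `0` only `τ = ∅` occurs, with coefficient the constant term of `f ∅`. Every
  -- other multidegree is a cone over a vertex of its support.
  have hα0 : α ≠ 0 := by
    rintro rfl
    refine hα (funext fun τ => ?_)
    by_cases hτ : expo τ ≤ 0
    · have : τ = ∅ := by
        rw [← support_expo τ, le_antisymm hτ (zero_le), Finsupp.support_zero]
      subst this
      rw [slice, if_pos hτ]
      simpa [constantCoeff_eq] using h0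
    · rw [slice, if_neg hτ]; rfl
  obtain ⟨v, hv⟩ := Finsupp.support_nonempty_iff.2 hα0
  refine exists_koszulD_eq_of_cone v (fun τ hτ => ?_) _ (fun τ hne => ?_) ?_
  · by_cases hvτ : v ∈ τ
    · rwa [Finset.insert_eq_of_mem hvτ]
    · refine (expo_insert_le_iff hvτ α).2 ⟨hτ, ?_⟩
      rw [Finsupp.mem_support_iff] at hv ⊢
      simpa [expo_apply, hvτ] using hv
  · by_contra h'
    exact hne (by rw [slice, if_neg h'])
  · rw [← slice_koszulD, hf]
    funext τ
    simp [slice]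

end Slices

/-! ### Koszul homology of monomial ideals -/

section KoszulExact

variable {V : Type*} [Fintype V] [DecidableEq V] {k : Type*} [Field k]

/-- An element of the Koszul complex of `⨁ S(-a i)` that has homological degree `t` and internal
degree `d`. -/
def KoszulHomogeneous {ι : Type*} (a : ι → ℕ) (t d : ℕ)
    (f : Finset V → ι → MvPolynomial V k) : Prop :=
  ∀ τ i m, coeff m (f τ i) ≠ 0 → τ.card = t ∧ m.degree + τ.card + a i = d

/-- The vanishing of the Koszul homology `Tor_t(N, k)_d` of a submodule `N` of `⨁ S(-a i)`. -/
def KoszulExact {ι : Type*} (a : ι → ℕ) (N : Submodule (MvPolynomial V k) (ι → MvPolynomial V k))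
    (t d : ℕ) : Prop :=
  ∀ f : Finset V → ι → MvPolynomial V k, (∀ τ, f τ ∈ N) → KoszulHomogeneous a t d f →
    koszulD (X : V → MvPolynomial V k) f = 0 →
      ∃ w : Finset V → ι → MvPolynomial V k, (∀ τ, w τ ∈ N) ∧
        koszulD (X : V → MvPolynomial V k) w = f

/-- An ideal, as a submodule of a free module with basis `Unit`. -/
noncomputable def unitSubmodule (I : Ideal (MvPolynomial V k)) :
    Submodule (MvPolynomial V k) (Unit → MvPolynomial V k) :=
  Submodule.comap (LinearMap.proj ()) I

lemma koszulD_apply_index {ι : Type*} (f : Finset V → ι → MvPolynomial V k) (τ : Finset V) (i : ι) :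
    koszulD (X : V → MvPolynomial V k) f τ i =
      koszulD (X : V → MvPolynomial V k) (fun τ => f τ i) τ :=
  (congrFun (koszulD_map (LinearMap.proj i) X f) τ).symm

/-- The Koszul homology of a monomial ideal is computed in each multidegree. -/
lemma koszulExact_unitSubmodule_iff {I : Ideal (MvPolynomial V k)} {Q : Finset V → Prop}
    (hI : ∀ f, f ∈ I ↔ ∀ m ∈ f.support, Q m.support) (t d : ℕ) :
    KoszulExact (fun _ => 0) (unitSubmodule I) t d ↔ ∀ α : V →₀ ℕ, α.degree = d →
      BoundaryExact k (fun τ => expo τ ≤ α ∧ Q (α - expo τ).support) t := by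
  have hmem : ∀ f : Finset V → MvPolynomial V k, (∀ τ, f τ ∈ I) ↔
      ∀ α τ, slice α f τ ≠ 0 → expo τ ≤ α ∧ Q (α - expo τ).support := by
    intro f
    constructor
    · intro h α τ hne
      by_cases hτ : expo τ ≤ α
      · rw [slice, if_pos hτ] at hne
        exact ⟨hτ, (hI _).1 (h τ) _ (mem_support_iff.2 hne)⟩
      · rw [slice, if_neg hτ] at hne
        exact absurd rfl hne
    · intro h τ
      rw [hI]
      intro m hm
      have := (h (m + expo τ) τ (by simpa [slice] using hm)).2
      simpa using this
  constructor
  · intro h α hα c hc hDc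
    set f : Finset V → Unit → MvPolynomial V k :=
      fun τ _ => ofSlices {α} (fun _ => c) τ with hf
    have hs : ∀ β, slice β (fun τ => f τ ()) = if β = α then c else 0 := by
      intro β
      have hcα : ∀ τ, c τ ≠ 0 → expo τ ≤ α := fun τ h => (hc τ h).1.1
      have := slice_ofSlices {α} (fun β => if β = α then c else 0) (fun γ τ hne => by
        by_cases hγ : γ = α
        · subst hγ; exact hcα τ (by simpa using hne)
        · simp [hγ] at hne) β
      simp only [Finset.mem_singleton] at this
      rw [show (fun τ => f τ ()) = ofSlices {α} (fun β => if β = α then c else 0) by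
        funext τ; simp [hf, ofSlices], this]
      split_ifs <;> rfl
    have hfI : ∀ τ, f τ ∈ unitSubmodule I := (hmem fun τ => f τ ()).2 fun β τ hne => by
      rw [hs] at hne
      split_ifs at hne with hβ
      · subst hβ; exact (hc τ hne).1
      · exact absurd rfl hne
    have hfhom : KoszulHomogeneous (fun _ => 0) t d f := by
      intro τ i m hm
      have h1 := congrFun (hs (m + expo τ)) τ
      rw [slice, if_pos (by simp), add_tsub_cancel_right] at h1
      rw [h1] at hm
      split_ifs at hm with hβ
      · refine ⟨(hc τ hm).2, ?_⟩
        rw [← hα, ← hβ, map_add, degree_expo, add_zero]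
      · exact absurd rfl hm
    have hfD : koszulD (X : V → MvPolynomial V k) f = 0 := by
      funext τ i
      rw [koszulD_apply_index]
      refine congrFun (slice_ext (f := koszulD (X : V → MvPolynomial V k) fun τ => f τ ())
        (g := 0) fun β => ?_) τ
      rw [slice_koszulD, hs]
      have h0 : slice β (0 : Finset V → MvPolynomial V k) = 0 := by funext τ; simp [slice]
      rw [h0]
      split_ifs
      · exact hDc
      · exact map_zero _
    obtain ⟨w, hwI, hw⟩ := h f hfI hfhom hfD
    refine ⟨slice α (fun τ => w τ ()), (hmem _).1 hwI α, ?_⟩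
    have hw' : koszulD (X : V → MvPolynomial V k) (fun τ => w τ ()) = fun τ => f τ () := by
      funext τ; rw [← koszulD_apply_index, hw]
    rw [← slice_koszulD, hw', hs, if_pos rfl]
  · intro h f hf hhom hDf
    obtain ⟨u, hu, hus⟩ := exists_koszulD_eq_of_slices
      (P := fun α τ => expo τ ≤ α ∧ Q (α - expo τ).support) (fun _ _ h => h.1) (fun τ => f τ ())
      (fun α hα => by
        have hcomp : ∀ τ, slice α (fun τ => f τ ()) τ ≠ 0 → τ.card = t ∧ α.degree = d := by
          intro τ hne
          by_cases hτ : expo τ ≤ α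
          · rw [slice, if_pos hτ] at hne
            refine ⟨(hhom τ () _ hne).1, ?_⟩
            rw [← (hhom τ () _ hne).2, add_zero]
            conv_lhs => rw [← tsub_add_cancel_of_le hτ, map_add, degree_expo]
          · rw [slice, if_neg hτ] at hne
            exact absurd rfl hne
        obtain ⟨τ, hτ⟩ := Function.ne_iff.1 hα
        refine h α (hcomp τ hτ).2 _ (fun τ hne => ⟨(hmem _).1 hf α τ hne, (hcomp τ hne).1⟩) ?_
        rw [← slice_koszulD, show koszulD (X : V → MvPolynomial V k) (fun τ => f τ ()) = 0 by
          funext τ; rw [← koszulD_apply_index, hDf]; rfl]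
        funext τ; simp [slice])
    refine ⟨fun τ _ => u τ, (hmem u).2 hus, ?_⟩
    funext τ i
    rw [koszulD_apply_index]
    exact congrFun hu τ

/-- Adding `v` to `τ` leaves the exponent at `v` positive, hence does not change the support of `α -
expo τ`: the family is a cone with apex `v`. -/
lemma boundaryExact_of_two_le {Q : Finset V → Prop} {α : V →₀ ℕ} {v : V} (hv : 2 ≤ α v) (t : ℕ) :
    BoundaryExact k (fun τ => expo τ ≤ α ∧ Q (α - expo τ).support) t := by
  refine boundaryExact_of_cone v (fun τ hτ => ?_) t
  by_cases hvτ : v ∈ τ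
  · rwa [Finset.insert_eq_of_mem hvτ]
  have hs : (α - expo (insert v τ)).support = (α - expo τ).support := by
    ext u
    simp only [Finsupp.mem_support_iff, Finsupp.tsub_apply, expo_apply, Finset.mem_insert]
    by_cases hu : u = v
    · subst hu; simp [hvτ]; omega
    · simp [hu]
  refine ⟨(expo_insert_le_iff hvτ α).2 ⟨hτ.1, ?_⟩, hs ▸ hτ.2⟩
  simp [expo_apply, hvτ]
  omega

lemma boundaryExact_expo_iff {Q : Finset V → Prop} (W : Finset V) (t : ℕ) :
    BoundaryExact k (fun τ => expo τ ≤ expo W ∧ Q (expo W - expo τ).support) t ↔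
      BoundaryExact k (fun τ => τ ⊆ W ∧ Q (W \ τ)) t := by
  have : ∀ τ, (expo W - expo τ).support = W \ τ := by
    intro τ
    ext u
    simp only [Finsupp.mem_support_iff, Finsupp.tsub_apply, expo_apply, Finset.mem_sdiff]
    by_cases h1 : u ∈ W <;> by_cases h2 : u ∈ τ <;> simp [h1, h2]
  simp only [this, expo_le_expo]

lemma eq_expo_or_two_le (α : V →₀ ℕ) : α = expo α.support ∨ ∃ v, 2 ≤ α v := by
  by_contra! h
  refine h.1 (Finsupp.ext fun v => ?_)
  have := h.2 v
  rw [expo_apply]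
  split_ifs with hv <;> rw [Finsupp.mem_support_iff] at hv <;> omega

end KoszulExact

/-! ### Homogeneous components in shifted free modules -/

section Parts

variable {V : Type*} {k : Type*} [Field k]

lemma isHomogeneous_iff_degree {f : MvPolynomial V k} {n : ℕ} :
    f.IsHomogeneous n ↔ ∀ m ∈ f.support, m.degree = n := by
  have h : ∀ m : V →₀ ℕ, Finsupp.weight 1 m = m.degree := fun m =>
    (DFunLike.congr_fun (Finsupp.degree_eq_weight_one (R := ℕ)) m).symm
  constructor
  · intro hf m hm
    rw [← h]
    exact hf (mem_support_iff.1 hm)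
  · intro hf m hm
    rw [h]
    exact hf m (mem_support_iff.2 hm)

/-- The component of degree `n` of an element of `S(-e)`. -/
noncomputable def part (n e : ℕ) : MvPolynomial V k →ₗ[k] MvPolynomial V k :=
  -- Without the guard, truncated subtraction would return the constant term when `n < e`.
  if e ≤ n then homogeneousComponent (n - e) else 0

lemma coeff_part (n e : ℕ) (f : MvPolynomial V k) (m : V →₀ ℕ) :
    coeff m (part n e f) = if m.degree + e = n then coeff m f else 0 := by
  unfold part
  by_cases h : e ≤ n
  · rw [if_pos h, coeff_homogeneousComponent]
    congr 1
    exact propext (by omega)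
  · rw [if_neg h, if_neg (by omega)]
    simp

lemma part_mul {e e' : ℕ} (n : ℕ) {g : MvPolynomial V k}
    (hg : ∀ m ∈ g.support, m.degree + e = e') (f : MvPolynomial V k) :
    part n e (g * f) = g * part n e' f := by
  classical
  ext m
  rw [coeff_part, coeff_mul, coeff_mul]
  have hterm : ∀ x ∈ Finset.HasAntidiagonal.antidiagonal m, coeff x.1 g * coeff x.2 (part n e' f) =
      if m.degree + e = n then coeff x.1 g * coeff x.2 f else 0 := by
    intro x hx
    by_cases h0 : coeff x.1 g = 0
    · simp [h0]
    · have h1 := hg x.1 (mem_support_iff.2 h0)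
      have h2 : m.degree = x.1.degree + x.2.degree := by
        rw [← map_add, Finset.HasAntidiagonal.mem_antidiagonal.1 hx]
      have h3 : x.2.degree + e' = n ↔ m.degree + e = n := by omega
      rw [coeff_part]
      simp only [h3]
      split_ifs <;> simp
  rw [Finset.sum_congr rfl hterm]
  split_ifs <;> simp

/-- The component of degree `n` of an element of `⨁ S(-a i)`. -/
noncomputable def freePart {ι : Type*} (a : ι → ℕ) (n : ℕ) (x : ι → MvPolynomial V k) :
    ι → MvPolynomial V k := fun i => part n (a i) (x i)

/-- The differential `⨁ S(-b j) → ⨁ S(-a i)` with matrix `φ` preserves degrees. -/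
def MatrixHomogeneous {ι κ : Type*} (a : ι → ℕ) (b : κ → ℕ)
    (φ : Matrix ι κ (MvPolynomial V k)) : Prop :=
  ∀ i j, ∀ m ∈ (φ i j).support, m.degree + a i = b j

lemma MatrixHomogeneous.part_mulVec {ι κ : Type*} [Fintype κ] {a : ι → ℕ} {b : κ → ℕ}
    {φ : Matrix ι κ (MvPolynomial V k)} (hφ : MatrixHomogeneous a b φ) (n e : ℕ)
    (x : κ → MvPolynomial V k) (i : ι) :
    part n (e + a i) (φ.mulVec x i) = φ.mulVec (fun j => part n (e + b j) (x j)) i := by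
  simp only [Matrix.mulVec, dotProduct, map_sum]
  refine Finset.sum_congr rfl fun j _ => part_mul n (fun m hm => ?_) _
  have := hφ i j m hm
  omega

lemma MatrixHomogeneous.freePart_mulVec {ι κ : Type*} [Fintype κ] {a : ι → ℕ} {b : κ → ℕ}
    {φ : Matrix ι κ (MvPolynomial V k)} (hφ : MatrixHomogeneous a b φ) (n : ℕ)
    (x : κ → MvPolynomial V k) : freePart a n (φ.mulVec x) = φ.mulVec (freePart b n x) := by
  funext i
  have := hφ.part_mulVec n 0 x i
  simp only [zero_add] at this
  exact this

end Parts

/-! ### Degrees in a minimal resolution from Koszul homology -/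

section Tor

variable {V : Type*} [Fintype V] [DecidableEq V] {k : Type*} [Field k]

/-- The component of homological degree `t` and internal degree `d` of an element of the Koszul
complex. -/
noncomputable def koszulPart {ι : Type*} (a : ι → ℕ) (t d : ℕ)
    (f : Finset V → ι → MvPolynomial V k) : Finset V → ι → MvPolynomial V k :=
  fun τ i => if τ.card = t then part d (τ.card + a i) (f τ i) else 0

omit [Fintype V] [DecidableEq V] in
lemma koszulHomogeneous_koszulPart {ι : Type*} (a : ι → ℕ) (t d : ℕ)
    (f : Finset V → ι → MvPolynomial V k) : KoszulHomogeneous a t d (koszulPart a t d f) := by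
  intro τ i m hm
  unfold koszulPart at hm
  split_ifs at hm with h
  · refine ⟨h, ?_⟩
    rw [coeff_part] at hm
    split_ifs at hm with h'
    · omega
    · exact absurd rfl hm
  · simp at hm

omit [Fintype V] [DecidableEq V] in
lemma KoszulHomogeneous.koszulPart_eq {ι : Type*} {a : ι → ℕ} {t d : ℕ}
    {f : Finset V → ι → MvPolynomial V k} (hf : KoszulHomogeneous a t d f) :
    koszulPart a t d f = f := by
  funext τ i
  ext m
  unfold koszulPart
  by_cases h0 : coeff m (f τ i) = 0
  · split_ifs
    · rw [coeff_part, h0]; simp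
    · rw [h0]; simp
  · obtain ⟨h1, h2⟩ := hf τ i m h0
    rw [if_pos h1, coeff_part, if_pos (by omega)]

/-- Multiplication by a variable raises the polynomial degree by one while contraction lowers the
cardinality by one. Preimages of homogeneous elements can therefore be cut down to homogeneous ones.
-/
lemma koszulD_koszulPart {ι : Type*} (a : ι → ℕ) (t d : ℕ)
    (f : Finset V → ι → MvPolynomial V k) :
    koszulD (X : V → MvPolynomial V k) (koszulPart a (t + 1) d f) =
      koszulPart a t d (koszulD (X : V → MvPolynomial V k) f) := by
  funext τ i
  rw [koszulD_apply_index, koszulD_apply_apply]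
  unfold koszulPart
  rw [koszulD_apply_index, koszulD_apply_apply]
  by_cases hτ : τ.card = t
  · rw [if_pos hτ, map_sum]
    refine Finset.sum_congr rfl fun v _ => ?_
    rw [contract_apply, contract_apply]
    by_cases hv : v ∈ τ
    · simp [hv]
    · rw [if_neg hv, if_neg hv, if_pos (by rw [Finset.card_insert_of_notMem hv, hτ]), smul_eq_mul,
        smul_eq_mul, part_mul (e' := (insert v τ).card + a i), map_zsmul]
      intro m hm
      rw [Finset.card_insert_of_notMem hv]
      rw [support_X, Finset.mem_singleton] at hm
      rw [hm, Finsupp.degree_single]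
      omega
  · rw [if_neg hτ]
    refine Finset.sum_eq_zero fun v _ => ?_
    rw [contract_apply]
    split_ifs with hv h
    · simp
    · exact absurd (by rw [Finset.card_insert_of_notMem hv] at h; omega) hτ
    · simp

lemma exists_koszulD_X_eq_pi {ι : Type*} (f : Finset V → ι → MvPolynomial V k)
    (hf : koszulD (X : V → MvPolynomial V k) f = 0) (h0 : ∀ i, constantCoeff (f ∅ i) = 0) :
    ∃ u : Finset V → ι → MvPolynomial V k, koszulD (X : V → MvPolynomial V k) u = f := by
  have : ∀ i, ∃ u : Finset V → MvPolynomial V k,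
      koszulD (X : V → MvPolynomial V k) u = fun τ => f τ i := fun i =>
    exists_koszulD_X_eq _ (by funext τ; rw [← koszulD_apply_index, hf]; rfl) (h0 i)
  choose u hu using this
  refine ⟨fun τ i => u i τ, ?_⟩
  funext τ i
  rw [koszulD_apply_index]
  exact congrFun (hu i) τ

lemma constantCoeff_koszulD_X {ι : Type*} (f : Finset V → ι → MvPolynomial V k) (τ : Finset V)
    (i : ι) : constantCoeff (koszulD (X : V → MvPolynomial V k) f τ i) = 0 := by
  rw [koszulD_apply_index, koszulD_apply_apply, map_sum]
  exact Finset.sum_eq_zero fun v _ => by simp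

variable {ι κ : Type*} [Fintype κ] {a : ι → ℕ} {b : κ → ℕ} {φ : Matrix ι κ (MvPolynomial V k)}

omit [Fintype V] [DecidableEq V] in
lemma MatrixHomogeneous.koszulPart_mulVec (hφ : MatrixHomogeneous a b φ) (t d : ℕ)
    (u : Finset V → κ → MvPolynomial V k) :
    koszulPart a t d (fun τ => φ.mulVec (u τ)) = fun τ => φ.mulVec (koszulPart b t d u τ) := by
  funext τ i
  unfold koszulPart
  by_cases h : τ.card = t
  · simp only [if_pos h]
    exact hφ.part_mulVec d _ _ _
  · simp only [if_neg h]
    exact (congrFun (φ.mulVec_zero) i).symm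

lemma koszulD_mulVec (u : Finset V → κ → MvPolynomial V k) :
    koszulD (X : V → MvPolynomial V k) (fun τ => φ.mulVec (u τ)) =
      fun τ => φ.mulVec (koszulD (X : V → MvPolynomial V k) u τ) :=
  koszulD_map φ.mulVecLin X u

/-- Dimension shifting along a minimal presentation. -/
lemma koszulExact_range_succ_iff (hφ : MatrixHomogeneous a b φ)
    (hmin : ∀ z ∈ LinearMap.ker φ.mulVecLin, ∀ j, constantCoeff (z j) = 0) (t d : ℕ) :
    KoszulExact a (LinearMap.range φ.mulVecLin) (t + 1) d ↔
      KoszulExact b (LinearMap.ker φ.mulVecLin) t d := by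
  constructor
  · intro h y hy hyhom hDy
    -- The kernel lies in `𝔪 F`, so `y` bounds some `u` in the acyclic Koszul complex of `F`; then
    -- `φ u` is a cycle in the image.
    obtain ⟨u₀, hu₀⟩ := exists_koszulD_X_eq_pi y hDy fun j => hmin _ (hy ∅) j
    set u := koszulPart b (t + 1) d u₀ with hu
    have hDu : koszulD (X : V → MvPolynomial V k) u = y := by
      rw [hu, koszulD_koszulPart, hu₀, hyhom.koszulPart_eq]
    obtain ⟨w, hw, hDw⟩ := h (fun τ => φ.mulVec (u τ)) (fun τ => ⟨u τ, rfl⟩)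
      (by rw [hu, ← hφ.koszulPart_mulVec]; exact koszulHomogeneous_koszulPart _ _ _ _)
      (by rw [koszulD_mulVec, hDu]; funext τ; exact hy τ)
    choose w' hw' using hw
    have hw'' : (fun τ => φ.mulVec (w' τ)) = w := funext hw'
    -- Correcting `u` by a boundary moves it into the kernel without changing its differential.
    refine ⟨u - koszulD (X : V → MvPolynomial V k) w', fun τ => ?_, by
      rw [map_sub, koszulD_koszulD, sub_zero, hDu]⟩
    rw [LinearMap.mem_ker, Matrix.mulVecLin_apply, Pi.sub_apply, Matrix.mulVec_sub, sub_eq_zero]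
    rw [← hw'', koszulD_mulVec] at hDw
    exact (congrFun hDw τ).symm
  · intro h z hz hzhom hDz
    choose u₀ hu₀ using hz
    have hu₀' : (fun τ => φ.mulVec (u₀ τ)) = z := funext hu₀
    set u := koszulPart b (t + 1) d u₀ with hu
    have hφu : (fun τ => φ.mulVec (u τ)) = z := by
      rw [hu, ← hφ.koszulPart_mulVec, hu₀', hzhom.koszulPart_eq]
    obtain ⟨w, hw, hDw⟩ := h (koszulD (X : V → MvPolynomial V k) u) (fun τ => by
        rw [LinearMap.mem_ker, Matrix.mulVecLin_apply]
        have := koszulD_mulVec (φ := φ) u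
        rw [hφu, hDz] at this
        exact (congrFun this τ).symm)
      (by rw [hu, koszulD_koszulPart]; exact koszulHomogeneous_koszulPart _ _ _ _)
      (koszulD_koszulD _ _)
    -- The component of `u` at `∅` vanishes because its homological degree is `t + 1`, and that of
    -- `w` lies in `𝔪 F`; so `u - w` is a boundary.
    obtain ⟨u', hu'⟩ := exists_koszulD_X_eq_pi (u - w) (by rw [map_sub, hDw, sub_self]) fun j => by
      have h1 : u ∅ j = 0 := by simp [hu, koszulPart]
      rw [Pi.sub_apply, Pi.sub_apply, h1, zero_sub, map_neg, hmin _ (hw ∅) j, neg_zero]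
    refine ⟨fun τ => φ.mulVec (u' τ), fun τ => ⟨u' τ, rfl⟩, ?_⟩
    rw [koszulD_mulVec, hu', ← hφu]
    funext τ
    have : φ.mulVec (w τ) = 0 := hw τ
    rw [Pi.sub_apply, Matrix.mulVec_sub, this, sub_zero]

/-- In homological degree `0` the Koszul homology is `N / 𝔪 N`, of which the columns of a minimal
matrix form a basis. -/
lemma koszulExact_range_zero_iff (hφ : MatrixHomogeneous a b φ)
    (hmin : ∀ z ∈ LinearMap.ker φ.mulVecLin, ∀ j, constantCoeff (z j) = 0) (d : ℕ) :
    KoszulExact a (LinearMap.range φ.mulVecLin) 0 d ↔ ∀ j, b j ≠ d := by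
  classical
  constructor
  · rintro h j rfl
    set e : Finset V → κ → MvPolynomial V k := fun τ => if τ = ∅ then Pi.single j 1 else 0 with he
    have hDe : koszulD (X : V → MvPolynomial V k) e = 0 := by
      funext τ
      exact koszulD_eq_zero fun v _ => by simp [he]
    obtain ⟨w, hw, hDw⟩ := h (fun τ => φ.mulVec (e τ)) (fun τ => ⟨e τ, rfl⟩) (by
      intro τ i m hm
      by_cases hτ : τ = ∅
      · subst hτ
        have : φ.mulVec (e ∅) i = φ i j := by simp [he]
        beta_reduce at hm
        rw [this] at hm
        have := hφ i j m (mem_support_iff.2 hm)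
        simpa using this
      · simp [he, hτ] at hm) (by
      rw [koszulD_mulVec, hDe]; funext τ; exact φ.mulVec_zero)
    choose w' hw' using hw
    have hw'' : (fun τ => φ.mulVec (w' τ)) = w := funext hw'
    rw [← hw'', koszulD_mulVec] at hDw
    -- If the `j`-th generator were in `𝔪 N`, the kernel would contain a vector with constant term
    -- `1` at `j`.
    have h1 : constantCoeff ((e ∅ - koszulD (X : V → MvPolynomial V k) w' ∅) j) = 0 :=
      hmin _ (by
        rw [LinearMap.mem_ker, Matrix.mulVecLin_apply, Matrix.mulVec_sub, sub_eq_zero]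
        exact (congrFun hDw ∅).symm) j
    rw [Pi.sub_apply, map_sub, constantCoeff_koszulD_X] at h1
    simp [he] at h1
  · intro h z hz hzhom _
    choose u₀ hu₀ using hz
    have hu₀' : (fun τ => φ.mulVec (u₀ τ)) = z := funext hu₀
    set u := koszulPart b 0 d u₀ with hu
    have hφu : (fun τ => φ.mulVec (u τ)) = z := by
      rw [hu, ← hφ.koszulPart_mulVec, hu₀', hzhom.koszulPart_eq]
    have hDu : koszulD (X : V → MvPolynomial V k) u = 0 := by
      funext τ
      refine koszulD_eq_zero fun v hv => ?_
      funext j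
      simp [hu, koszulPart]
    obtain ⟨u', hu'⟩ := exists_koszulD_X_eq_pi u hDu fun j => by
      rw [constantCoeff_eq]
      by_contra hne
      have := (koszulHomogeneous_koszulPart b 0 d u₀ ∅ j 0 hne).2
      simp at this
      exact h j this
    exact ⟨fun τ => φ.mulVec (u' τ), fun τ => ⟨u' τ, rfl⟩, by rw [koszulD_mulVec, hu', hφu]⟩

variable {I : Ideal (MvPolynomial V k)}

/-- The augmentation `F_0 → I` as a matrix with one row. -/
def MinimalGradedFreeResolution.aug (F : MinimalGradedFreeResolution I) :
    Matrix Unit (Fin (F.rank 0)) (MvPolynomial V k) := fun _ b => F.gen b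

omit [Fintype V] [DecidableEq V] in
lemma MinimalGradedFreeResolution.range_aug (F : MinimalGradedFreeResolution I) :
    LinearMap.range F.aug.mulVecLin = unitSubmodule I := by
  ext x
  have hI : x () ∈ I ↔
      x () ∈ LinearMap.range (Fintype.linearCombination (MvPolynomial V k) F.gen) := by
    rw [Fintype.range_linearCombination, ← Ideal.span, F.span_gen]
  rw [unitSubmodule, Submodule.mem_comap, LinearMap.proj_apply, hI]
  constructor
  · rintro ⟨y, rfl⟩
    refine ⟨y, ?_⟩
    simp [Fintype.linearCombination_apply, MinimalGradedFreeResolution.aug, Matrix.mulVec,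
      dotProduct, mul_comm]
  · rintro ⟨y, hy⟩
    refine ⟨y, ?_⟩
    funext i
    simpa [Fintype.linearCombination_apply, MinimalGradedFreeResolution.aug, Matrix.mulVec,
      dotProduct, mul_comm] using hy

omit [Fintype V] [DecidableEq V] in
lemma MinimalGradedFreeResolution.ker_aug (F : MinimalGradedFreeResolution I) :
    LinearMap.ker F.aug.mulVecLin = LinearMap.range (F.φ 0).mulVecLin := by
  rw [F.exact_zero]
  ext y
  rw [LinearMap.mem_ker, LinearMap.mem_ker, funext_iff]
  simp [Fintype.linearCombination_apply, MinimalGradedFreeResolution.aug, Matrix.mulVec,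
    dotProduct, mul_comm]

omit [Fintype V] [DecidableEq V] in
lemma MinimalGradedFreeResolution.constantCoeff_of_mem_range (F : MinimalGradedFreeResolution I)
    (t : ℕ) : ∀ z ∈ LinearMap.range (F.φ t).mulVecLin, ∀ j, constantCoeff (z j) = 0 := by
  rintro _ ⟨y, rfl⟩ j
  simp [Matrix.mulVec, dotProduct, F.minimal]

/-- The image of `φ s` is resolved by the tail of the resolution starting at `F_{s+1}`, so `t`
dimension shifts reach `F_{s+t+1}`. The separate index `n` keeps `F.deg n` free of casts. -/
lemma MinimalGradedFreeResolution.koszulExact_range_iff (F : MinimalGradedFreeResolution I)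
    (t d : ℕ) : ∀ s n, n = s + t + 1 →
      (KoszulExact (F.deg s) (LinearMap.range (F.φ s).mulVecLin) t d ↔ ∀ j, F.deg n j ≠ d) := by
  have hmin : ∀ s, ∀ z ∈ LinearMap.ker (F.φ s).mulVecLin, ∀ j, constantCoeff (z j) = 0 :=
    fun s => by rw [← F.exact_succ s]; exact F.constantCoeff_of_mem_range (s + 1)
  induction t with
  | zero =>
    rintro s _ rfl
    exact koszulExact_range_zero_iff (F.φ_homogeneous s) (hmin s) d
  | succ t ih =>
    intro s n hn
    rw [koszulExact_range_succ_iff (F.φ_homogeneous s) (hmin s), ← F.exact_succ s]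
    exact ih (s + 1) n (by omega)

/-- The degrees of the bases of a minimal free resolution are those of the Koszul homology. -/
lemma MinimalGradedFreeResolution.koszulExact_iff (F : MinimalGradedFreeResolution I) (t d : ℕ) :
    KoszulExact (fun _ => 0) (unitSubmodule I) t d ↔ ∀ j, F.deg t j ≠ d := by
  have hhom : MatrixHomogeneous (fun _ => 0) (F.deg 0) F.aug := by
    intro _ j m hm
    exact isHomogeneous_iff_degree.1 (F.gen_homogeneous j) m hm
  have hmin : ∀ z ∈ LinearMap.ker F.aug.mulVecLin, ∀ j, constantCoeff (z j) = 0 := by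
    rw [F.ker_aug]; exact F.constantCoeff_of_mem_range 0
  rw [← F.range_aug]
  cases t with
  | zero => exact koszulExact_range_zero_iff hhom hmin d
  | succ t =>
    rw [koszulExact_range_succ_iff hhom hmin, F.ker_aug]
    exact F.koszulExact_range_iff t d 0 (t + 1) (by omega)

end Tor

/-! ### Existence of minimal graded free resolutions -/

section Existence

variable {V : Type*} {k : Type*} [Field k]

/-- A submodule of `⨁ S(-a i)` is homogeneous if it contains the components of its elements. -/
def IsGradedSubmodule {ι : Type*} (a : ι → ℕ)
    (N : Submodule (MvPolynomial V k) (ι → MvPolynomial V k)) : Prop :=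
  ∀ x ∈ N, ∀ d, freePart a d x ∈ N

lemma sum_freePart {ι : Type*} [Fintype ι] (a : ι → ℕ) (x : ι → MvPolynomial V k) :
    ∃ D : Finset ℕ, ∑ d ∈ D, freePart a d x = x := by
  classical
  refine ⟨Finset.univ.biUnion fun i => (x i).support.image fun m => m.degree + a i, ?_⟩
  funext i
  ext m
  rw [Finset.sum_apply, coeff_sum]
  simp only [freePart, coeff_part]
  rw [Finset.sum_ite_eq]
  split_ifs with h
  · rfl
  · by_contra hne
    exact h (Finset.mem_biUnion.2 ⟨i, Finset.mem_univ _, Finset.mem_image.2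
      ⟨m, mem_support_iff.2 (Ne.symm hne), rfl⟩⟩)

lemma MatrixHomogeneous.isGradedSubmodule_ker {ι κ : Type*} [Fintype κ] {a : ι → ℕ} {b : κ → ℕ}
    {φ : Matrix ι κ (MvPolynomial V k)} (hφ : MatrixHomogeneous a b φ) :
    IsGradedSubmodule b (LinearMap.ker φ.mulVecLin) := by
  intro x hx d
  rw [LinearMap.mem_ker, Matrix.mulVecLin_apply] at hx ⊢
  rw [← hφ.freePart_mulVec, hx]
  funext i
  simp [freePart]

lemma degree_of_mem_support_freePart {ι : Type*} {a : ι → ℕ} {d : ℕ} {x : ι → MvPolynomial V k}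
    {i : ι} {m : V →₀ ℕ} (h : m ∈ (freePart a d x i).support) : m.degree + a i = d := by
  rw [mem_support_iff, freePart, coeff_part] at h
  by_contra h'
  exact h (if_neg h')

lemma exists_homogeneous_generators [Finite V] {ι : Type*} [Fintype ι] {a : ι → ℕ}
    {N : Submodule (MvPolynomial V k) (ι → MvPolynomial V k)} (hN : IsGradedSubmodule a N) :
    ∃ (r : ℕ) (b : Fin r → ℕ) (φ : Matrix ι (Fin r) (MvPolynomial V k)),
      MatrixHomogeneous a b φ ∧ LinearMap.range φ.mulVecLin = N := by
  set T : Set (ι → MvPolynomial V k) := {y | y ∈ N ∧ ∃ d, ∀ i, ∀ m ∈ (y i).support,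
    m.degree + a i = d} with hT
  have hspan : Submodule.span (MvPolynomial V k) T = N := by
    refine le_antisymm (Submodule.span_le.2 fun y hy => hy.1) fun x hx => ?_
    obtain ⟨D, hD⟩ := sum_freePart a x
    rw [← hD]
    exact Submodule.sum_mem _ fun d _ => Submodule.subset_span
      ⟨hN x hx d, d, fun i m hm => degree_of_mem_support_freePart hm⟩
  have hfg : (Submodule.span (MvPolynomial V k) T).FG := IsNoetherian.noetherian _
  obtain ⟨s, hsT, hs⟩ := (Submodule.fg_span_iff_fg_span_finset_subset _).1 hfg
  have hdeg : ∀ j : Fin s.card, ∃ d, ∀ i,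
      ∀ m ∈ ((s.equivFin.symm j : ι → MvPolynomial V k) i).support, m.degree + a i = d :=
    fun j => (hsT (s.equivFin.symm j).2).2
  choose b hb using hdeg
  refine ⟨s.card, b, Matrix.of fun i j => (s.equivFin.symm j : ι → MvPolynomial V k) i,
    fun i j m hm => hb j i m hm, ?_⟩
  rw [Matrix.range_mulVecLin, ← hspan, hs]
  congr 1
  ext y
  constructor
  · rintro ⟨j, rfl⟩
    exact (s.equivFin.symm j).2
  · intro hy
    refine ⟨s.equivFin ⟨y, hy⟩, ?_⟩
    funext i
    simp [Matrix.col]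

/-- A homogeneous submodule has a minimal system of homogeneous generators. -/
lemma exists_minimal_homogeneous_generators [Finite V] {ι : Type*} [Fintype ι] {a : ι → ℕ}
    {N : Submodule (MvPolynomial V k) (ι → MvPolynomial V k)} (hN : IsGradedSubmodule a N) :
    ∃ (r : ℕ) (b : Fin r → ℕ) (φ : Matrix ι (Fin r) (MvPolynomial V k)),
      MatrixHomogeneous a b φ ∧ LinearMap.range φ.mulVecLin = N ∧
      ∀ z ∈ LinearMap.ker φ.mulVecLin, ∀ j, constantCoeff (z j) = 0 := by
  classical
  -- A homogeneous generating system with the fewest elements is minimal in the required sense.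
  have hex := exists_homogeneous_generators hN
  obtain ⟨b, φ, hφ, hrange⟩ := Nat.find_spec hex
  have hmin := fun r => Nat.find_min (m := r) hex
  revert b φ hmin
  generalize Nat.find hex = r
  intro b φ hφ hrange hmin
  refine ⟨r, b, φ, hφ, hrange, fun z hz j₀ => ?_⟩
  by_contra hne
  cases r with
  | zero => exact j₀.elim0
  | succ r =>
  refine hmin r (Nat.lt_succ_self r) ⟨fun j => b (j₀.succAbove j), φ.submatrix id j₀.succAbove,
    fun i j => hφ i _, ?_⟩
  rw [Matrix.range_mulVecLin, ← hrange, Matrix.range_mulVecLin]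
  set M := Submodule.span (MvPolynomial V k)
    (Set.range (φ.submatrix id j₀.succAbove).col) with hM
  have hcol : ∀ j, φ.col (j₀.succAbove j) ∈ M := fun j => Submodule.subset_span ⟨j, rfl⟩
  refine le_antisymm (Submodule.span_mono ?_) (Submodule.span_le.2 ?_)
  · rintro _ ⟨j, rfl⟩
    exact ⟨_, rfl⟩
  · rintro _ ⟨j, rfl⟩
    rw [SetLike.mem_coe]
    rcases Fin.eq_self_or_eq_succAbove j₀ j with rfl | ⟨l, rfl⟩
    -- In the degree-`b j` part of the relation `z`, the coefficient at `j` is a nonzero constant,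
    -- so this column is redundant.
    · have hz' := hφ.isGradedSubmodule_ker z hz (b j)
      set y := freePart b (b j) z with hy
      have hyj : y j = C (constantCoeff (z j)) := by
        ext m
        rw [hy, freePart, coeff_part, coeff_C, constantCoeff_eq]
        by_cases hm : m = 0
        · subst hm; simp
        · have : m.degree ≠ 0 := fun h => hm ((Finsupp.degree_eq_zero_iff m).1 h)
          rw [if_neg (by omega), if_neg (Ne.symm hm)]
      rw [LinearMap.mem_ker, Matrix.mulVecLin_apply, Matrix.mulVec_eq_sum,
        Fin.sum_univ_succAbove _ j] at hz'
      have hsum : (C (constantCoeff (z j)) : MvPolynomial V k) • φ.col j ∈ M := by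
        have e : (C (constantCoeff (z j)) : MvPolynomial V k) • φ.col j =
            -∑ l, y (j.succAbove l) • φ.col (j.succAbove l) := by
          rw [eq_neg_iff_add_eq_zero, ← hyj, ← hz']
          simp only [op_smul_eq_smul]
          rfl
        rw [e]
        exact neg_mem (Submodule.sum_mem _ fun l _ => Submodule.smul_mem _ _ (hcol l))
      have := Submodule.smul_mem M (C (constantCoeff (z j))⁻¹) hsum
      rwa [smul_smul, ← C_mul, inv_mul_cancel₀ hne, C_1, one_smul] at this
    · exact hcol l

variable (V k) in
/-- A homogeneous submodule of `𝔪 F`, `F = ⨁ S(-deg i)`. -/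
structure GradedSyzygies where
  /-- the rank of `F` -/
  r : ℕ
  /-- the degrees of the basis elements of `F` -/
  deg : Fin r → ℕ
  /-- the submodule -/
  N : Submodule (MvPolynomial V k) (Fin r → MvPolynomial V k)
  graded : IsGradedSubmodule deg N
  le_max : ∀ z ∈ N, ∀ j, constantCoeff (z j) = 0

namespace GradedSyzygies

variable [Finite V]

lemma exists_cover (M : GradedSyzygies V k) :
    ∃ (M' : GradedSyzygies V k) (φ : Matrix (Fin M.r) (Fin M'.r) (MvPolynomial V k)),
      MatrixHomogeneous M.deg M'.deg φ ∧ LinearMap.range φ.mulVecLin = M.N ∧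
      LinearMap.ker φ.mulVecLin = M'.N := by
  obtain ⟨r, b, φ, hφ, hr, hk⟩ := exists_minimal_homogeneous_generators M.graded
  exact ⟨⟨r, b, LinearMap.ker φ.mulVecLin, hφ.isGradedSubmodule_ker, hk⟩, φ, hφ, hr, rfl⟩

/-- The first syzygies of a minimal system of generators. -/
noncomputable def next (M : GradedSyzygies V k) : GradedSyzygies V k := M.exists_cover.choose

/-- The matrix of a minimal system of generators. -/
noncomputable def matrix (M : GradedSyzygies V k) :
    Matrix (Fin M.r) (Fin M.next.r) (MvPolynomial V k) := M.exists_cover.choose_spec.choose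

lemma matrix_spec (M : GradedSyzygies V k) :
    MatrixHomogeneous M.deg M.next.deg M.matrix ∧ LinearMap.range M.matrix.mulVecLin = M.N ∧
      LinearMap.ker M.matrix.mulVecLin = M.next.N := M.exists_cover.choose_spec.choose_spec

/-- The iterated syzygies. -/
noncomputable def iter (M : GradedSyzygies V k) : ℕ → GradedSyzygies V k
  | 0 => M
  | t + 1 => (iter M t).next

end GradedSyzygies

/-- A homogeneous ideal has a minimal graded free resolution. -/
lemma nonempty_minimalGradedFreeResolution [Finite V] {I : Ideal (MvPolynomial V k)}
    (hI : ∀ f ∈ I, ∀ d, part d 0 f ∈ I) : Nonempty (MinimalGradedFreeResolution I) := by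
  have hgr : IsGradedSubmodule (fun _ => 0) (unitSubmodule I) := fun x hx d => hI _ hx d
  obtain ⟨r, b, φ, hφ, hr, hk⟩ := exists_minimal_homogeneous_generators hgr
  set M : GradedSyzygies V k := ⟨r, b, LinearMap.ker φ.mulVecLin, hφ.isGradedSubmodule_ker, hk⟩
    with hM
  have hlin : ∀ y, Fintype.linearCombination (MvPolynomial V k) (fun j => φ () j) y =
      φ.mulVec y () := by
    intro y
    simp [Fintype.linearCombination_apply, Matrix.mulVec, dotProduct, mul_comm]
  have hker : LinearMap.ker φ.mulVecLin =
      LinearMap.ker (Fintype.linearCombination (MvPolynomial V k) fun j => φ () j) := by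
    ext y
    rw [LinearMap.mem_ker, LinearMap.mem_ker, hlin y, funext_iff]
    exact ⟨fun h => h (), fun h _ => h⟩
  have hcol : ∀ N : GradedSyzygies V k, ∀ i j, constantCoeff (N.matrix i j) = 0 := by
    intro N i j
    have := N.le_max (N.matrix.mulVec (Pi.single j 1)) (by
      rw [← N.matrix_spec.2.1]; exact ⟨_, rfl⟩) i
    simpa using this
  exact ⟨{
    rank := fun t => (M.iter t).r
    deg := fun t => (M.iter t).deg
    gen := fun j => φ () j
    φ := fun t => (M.iter t).matrix
    gen_homogeneous := fun j => isHomogeneous_iff_degree.2 fun m hm => hφ () j m hm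
    φ_homogeneous := fun t => (M.iter t).matrix_spec.1
    span_gen := by
      rw [Ideal.span, ← Fintype.range_linearCombination (MvPolynomial V k)]
      ext f
      have hf : f ∈ I ↔ (fun _ => f) ∈ unitSubmodule I := Iff.rfl
      rw [hf, ← hr]
      constructor
      · rintro ⟨y, rfl⟩
        exact ⟨y, funext fun _ => (hlin y).symm⟩
      · rintro ⟨y, hy⟩
        exact ⟨y, (hlin y).trans (congrFun hy ())⟩
    exact_zero := by
      exact (M.iter 0).matrix_spec.2.1.trans hker
    exact_succ := fun t => (M.iter (t + 1)).matrix_spec.2.1.trans (M.iter t).matrix_spec.2.2.symm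
    minimal := fun t => hcol (M.iter t) }⟩

end Existence

/-! ### Hochster's formula for Stanley-Reisner ideals and the main equivalences -/

section StanleyReisner

variable {V : Type*} {k : Type*} [Field k]

lemma mem_of_subset_of_mem {Δ : AbstractSimplicialComplex V} {σ τ : Finset V} (h : σ ⊆ τ)
    (hσ : σ.Nonempty) (hτ : τ ∈ Δ) : σ ∈ Δ :=
  Δ.isRelLowerSet_faces.mem_of_le hτ h hσ

variable (k) in
/-- The Stanley-Reisner ideal consists of the polynomials whose monomials are supported on
non-faces. -/
lemma mem_stanleyReisnerIdeal (Δ : AbstractSimplicialComplex V) (f : MvPolynomial V k) :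
    f ∈ stanleyReisnerIdeal k Δ ↔ ∀ m ∈ f.support, m.support.Nonempty ∧ m.support ∉ Δ := by
  classical
  have h : {f : MvPolynomial V k | ∃ s : Finset V, s.Nonempty ∧ s ∉ Δ ∧ f = ∏ v ∈ s, X v} =
      (fun s => monomial s (1 : k)) '' {α | ∃ s : Finset V, s.Nonempty ∧ s ∉ Δ ∧ α = expo s} := by
    ext f
    constructor
    · rintro ⟨s, hs, hsΔ, rfl⟩
      exact ⟨expo s, ⟨s, hs, hsΔ, rfl⟩, (prod_X_eq_monomial_expo s).symm⟩
    · rintro ⟨_, ⟨s, hs, hsΔ, rfl⟩, rfl⟩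
      exact ⟨s, hs, hsΔ, (prod_X_eq_monomial_expo s).symm⟩
  rw [stanleyReisnerIdeal, h, mem_ideal_span_monomial_image]
  refine forall₂_congr fun m _ => ⟨?_, fun hm => ?_⟩
  · rintro ⟨_, ⟨s, hs, hsΔ, rfl⟩, hle⟩
    have hsub : s ⊆ m.support := by
      have := Finsupp.support_mono hle
      rwa [support_expo] at this
    exact ⟨hs.mono hsub, fun h => hsΔ (mem_of_subset_of_mem hsub hs h)⟩
  · refine ⟨expo m.support, ⟨_, hm.1, hm.2, rfl⟩, fun v => ?_⟩
    rw [expo_apply]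
    split_ifs with hv
    · rw [Finsupp.mem_support_iff] at hv; omega
    · exact zero_le

lemma part_mem_stanleyReisnerIdeal (Δ : AbstractSimplicialComplex V) {f : MvPolynomial V k}
    (hf : f ∈ stanleyReisnerIdeal k Δ) (d : ℕ) : part d 0 f ∈ stanleyReisnerIdeal k Δ := by
  rw [mem_stanleyReisnerIdeal] at hf ⊢
  intro m hm
  rw [mem_support_iff, coeff_part] at hm
  split_ifs at hm
  · exact hf m (mem_support_iff.2 hm)
  · exact absurd rfl hm

lemma two_le_card_of_notMem {Δ : AbstractSimplicialComplex V} {σ : Finset V} (h : σ.Nonempty)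
    (hσ : σ ∉ Δ) : 2 ≤ σ.card := by
  by_contra! hlt
  have : σ.card = 1 := by have := h.card_pos; omega
  obtain ⟨v, rfl⟩ := Finset.card_eq_one.1 this
  exact hσ (Δ.singleton_mem v)

variable [Fintype V] [DecidableEq V]

/-- The vanishing of `Tor_t(I_Δ, k)_d`. -/
def TorVanishes (k : Type*) [Field k] (Δ : AbstractSimplicialComplex V) (t d : ℕ) : Prop :=
  KoszulExact (fun _ => 0) (unitSubmodule (stanleyReisnerIdeal k Δ)) t d

/-- Non-squarefree multidegrees are cones and drop out, which leaves one complex for each vertex set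
of size `d`. -/
lemma torVanishes_iff (Δ : AbstractSimplicialComplex V) (t d : ℕ) :
    TorVanishes k Δ t d ↔ ∀ W : Finset V, W.card = d →
      BoundaryExact k (fun τ => τ ⊆ W ∧ (W \ τ).Nonempty ∧ W \ τ ∉ Δ) t := by
  rw [TorVanishes, koszulExact_unitSubmodule_iff (Q := fun σ => σ.Nonempty ∧ σ ∉ Δ)
    (mem_stanleyReisnerIdeal k Δ)]
  constructor
  · intro h W hW
    exact (boundaryExact_expo_iff (Q := fun σ => σ.Nonempty ∧ σ ∉ Δ) W t).1
      (h (expo W) (by rw [degree_expo, hW]))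
  · intro h α hα
    rcases eq_expo_or_two_le α with hs | ⟨v, hv⟩
    · rw [hs] at hα ⊢
      rw [degree_expo] at hα
      exact (boundaryExact_expo_iff (Q := fun σ => σ.Nonempty ∧ σ ∉ Δ) _ t).2 (h _ hα)
    · exact boundaryExact_of_two_le (Q := fun σ => σ.Nonempty ∧ σ ∉ Δ) hv t

/-- A non-face has at least two elements, so the complex is zero at `t` when `d < t + 2`. -/
lemma torVanishes_of_lt (Δ : AbstractSimplicialComplex V) {t d : ℕ} (h : d < t + 2) :
    TorVanishes k Δ t d := by
  rw [torVanishes_iff]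
  intro W hW c hc _
  have : c = 0 := by
    funext τ
    by_contra hne
    obtain ⟨⟨hτ, hne', hΔ⟩, ht⟩ := hc τ hne
    have h1 := two_le_card_of_notMem hne' hΔ
    have h2 := Finset.card_sdiff_add_card_eq_card hτ
    omega
  exact ⟨0, by simp, by rw [this, map_zero]⟩

/-- Nonfaces are the sets that are not cliques of `G`. -/
def IsFlagFor (Δ : AbstractSimplicialComplex V) (G : SimpleGraph V) : Prop :=
  ∀ σ : Finset V, (σ.Nonempty ∧ σ ∉ Δ) ↔ ¬ G.IsClique (σ : Set V)

/-- Hochster's formula: Alexander duality in each `W`, with non-faces read as non-cliques. -/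
lemma IsFlagFor.torVanishes_iff {Δ : AbstractSimplicialComplex V} {G : SimpleGraph V}
    (hΔ : IsFlagFor Δ G) {t d q : ℕ} (hq : t + 1 + q = d) :
    TorVanishes k Δ t d ↔ ∀ W : Finset V, W.card = d →
      CoboundaryExact k (fun σ => G.IsClique (σ : Set V)) W q := by
  rw [LinearSyzygies.torVanishes_iff]
  refine forall₂_congr fun W hW => ?_
  have e : (fun τ : Finset V => τ ⊆ W ∧ (W \ τ).Nonempty ∧ W \ τ ∉ Δ) =
      fun τ => τ ⊆ W ∧ ¬ G.IsClique ((W \ τ : Finset V) : Set V) := by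
    funext τ
    rw [hΔ]
  have hne : W.Nonempty := Finset.card_pos.1 (by omega)
  rw [e]
  have hcard : t + 1 + q = W.card := by omega
  exact ⟨coboundaryExact_of_boundaryExact (F := fun σ : Finset V => G.IsClique (σ : Set V)) hne
      (fun σ h v _ => isClique_erase h v) hcard,
    boundaryExact_of_coboundaryExact (F := fun σ : Finset V => G.IsClique (σ : Set V)) hne hcard⟩

lemma IsFlagFor.torVanishes {Δ : AbstractSimplicialComplex V} {G : SimpleGraph V}
    (hΔ : IsFlagFor Δ G) {t d : ℕ}
    (hcyc : ∀ (u : V) (c : G.Walk u u), IsMinimalCycle c → t + 3 < c.length) (hd : t + 2 < d) :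
    TorVanishes k Δ t d := by
  obtain ⟨q, rfl⟩ : ∃ q, d = t + 1 + q := ⟨d - (t + 1), by omega⟩
  exact (hΔ.torVanishes_iff rfl).2 fun W hW =>
    coboundaryExact_of_forall_isMinimalCycle hcyc W q (by omega) (by omega)

/-- Take `W` to be the vertex set of the cycle and `q = 2`, so that `t = |W| - 3`. -/
lemma IsFlagFor.not_torVanishes {Δ : AbstractSimplicialComplex V} {G : SimpleGraph V}
    (hΔ : IsFlagFor Δ G) {v : V} {c : G.Walk v v} (hc : IsMinimalCycle c) :
    ¬ TorVanishes k Δ (c.length - 3) c.length := by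
  have hlen := hc.2.1
  intro h
  refine not_coboundaryExact_of_isMinimalCycle (k := k) hc
    ((hΔ.torVanishes_iff (q := 2) (by omega)).1 h _ ?_)
  -- The support lists the base vertex twice; its tail lists every vertex once.
  have h1 : c.support.toFinset = c.support.tail.toFinset := by
    ext x
    rw [List.mem_toFinset, List.mem_toFinset]
    refine ⟨fun hx => ?_, List.mem_of_mem_tail⟩
    rw [SimpleGraph.Walk.mem_support_iff] at hx
    rcases hx with rfl | hx
    · exact SimpleGraph.Walk.end_mem_tail_support hc.1.not_nil
    · exact hx
  rw [h1, List.toFinset_card_of_nodup hc.1.support_nodup, List.length_tail,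
    SimpleGraph.Walk.length_support, Nat.add_sub_cancel]

omit [Fintype V] in
lemma notMem_of_not_isClique_oneSkeleton {Δ : AbstractSimplicialComplex V} {σ : Finset V}
    (h : ¬ (oneSkeleton Δ).IsClique (σ : Set V)) : σ.Nonempty ∧ σ ∉ Δ := by
  rw [SimpleGraph.isClique_iff, Set.Pairwise] at h
  push Not at h
  obtain ⟨u, hu, v, hv, huv, hadj⟩ := h
  refine ⟨⟨u, hu⟩, fun hσ => hadj ⟨huv, mem_of_subset_of_mem (fun x hx => ?_) (by simp) hσ⟩⟩
  rw [Finset.mem_insert, Finset.mem_singleton] at hx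
  rcases hx with rfl | rfl
  · exact hu
  · exact hv

-- Testing squarefree monomials for membership in the two monomial ideals shows that every non-face
-- contains a generating pair, which is itself a non-face.
omit [Fintype V] in
lemma isFlagFor_oneSkeleton_of_isGeneratedBy {Δ : AbstractSimplicialComplex V}
    (h : IsGeneratedByQuadraticSquarefreeMonomials (stanleyReisnerIdeal k Δ)) :
    IsFlagFor Δ (oneSkeleton Δ) := by
  obtain ⟨E, hE, hI⟩ := h
  have hset : {f : MvPolynomial V k | ∃ e ∈ E, f = X e.1 * X e.2} =
      (fun s => monomial s (1 : k)) '' {α | ∃ e ∈ E, α = expo {e.1, e.2}} := by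
    have hX : ∀ e ∈ E, (X e.1 * X e.2 : MvPolynomial V k) = monomial (expo {e.1, e.2}) 1 := by
      intro e he
      rw [← prod_X_eq_monomial_expo, Finset.prod_pair (hE e he)]
    ext f
    constructor
    · rintro ⟨e, he, rfl⟩
      exact ⟨_, ⟨e, he, rfl⟩, (hX e he).symm⟩
    · rintro ⟨_, ⟨e, he, rfl⟩, rfl⟩
      exact ⟨e, he, (hX e he).symm⟩
  have hQ : ∀ σ : Finset V, (σ.Nonempty ∧ σ ∉ Δ) ↔ ∃ e ∈ E, ({e.1, e.2} : Finset V) ⊆ σ := by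
    intro σ
    have hsupp : (monomial (expo σ) (1 : k)).support = {expo σ} := by
      classical
      rw [support_monomial, if_neg one_ne_zero]
    have h1 := mem_stanleyReisnerIdeal k Δ (monomial (expo σ) 1)
    rw [hsupp] at h1
    simp only [Finset.mem_singleton, forall_eq, support_expo] at h1
    rw [← h1, hI, hset, mem_ideal_span_monomial_image, hsupp]
    simp only [Finset.mem_singleton, forall_eq, Set.mem_ofPred_eq]
    constructor
    · rintro ⟨_, ⟨e, he, rfl⟩, hle⟩
      exact ⟨e, he, expo_le_expo.1 hle⟩
    · rintro ⟨e, he, hle⟩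
      exact ⟨_, ⟨e, he, rfl⟩, expo_le_expo.2 hle⟩
  refine fun σ => ⟨fun hσ hcl => ?_, notMem_of_not_isClique_oneSkeleton⟩
  obtain ⟨e, he, hle⟩ := (hQ σ).1 hσ
  exact ((hQ {e.1, e.2}).2 ⟨e, he, subset_rfl⟩).2
    (hcl (hle (by simp)) (hle (by simp)) (hE e he)).2

/-- With no minimal generators above degree `2`, a non-face with at least three elements contains a
smaller one; descent ends at a missing edge. -/
lemma isFlagFor_oneSkeleton_of_torVanishes {Δ : AbstractSimplicialComplex V}
    (h : ∀ d, 2 < d → TorVanishes k Δ 0 d) : IsFlagFor Δ (oneSkeleton Δ) := by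
  classical
  refine fun σ => ⟨?_, notMem_of_not_isClique_oneSkeleton⟩
  induction σ using Finset.strongInduction with
  | H σ ih =>
  rintro ⟨hne, hσ⟩ hcl
  have h2 := two_le_card_of_notMem hne hσ
  rcases h2.eq_or_lt with hc | hc
  · obtain ⟨u, v, huv, rfl⟩ := Finset.card_eq_two.1 hc.symm
    exact hσ (hcl (by simp) (by simp) huv).2
  -- The point mass at `∅` represents the monomial of `σ`. A preimage is nonzero at some `{v}`, and
  -- then `σ \ {v}` is a non-face.
  · obtain ⟨b, hb, hDb⟩ := (torVanishes_iff Δ 0 σ.card).1 (h _ hc) σ rfl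
      (fun τ => if τ = ∅ then 1 else 0) (fun τ hτ => by
        by_cases hτ' : τ = ∅
        · subst hτ'; simp [hne, hσ]
        · simp [hτ'] at hτ)
      (by funext τ; exact koszulD_eq_zero fun v _ => by simp)
    have h1 := congrFun hDb ∅
    rw [if_pos rfl] at h1
    have hex : ∃ v, b {v} ≠ 0 := by
      by_contra! h0
      rw [koszulD_eq_zero fun v _ => by simpa using h0 v] at h1
      exact zero_ne_one h1
    obtain ⟨v, hv⟩ := hex
    obtain ⟨hvσ, hq⟩ := hb _ hv
    refine ih (σ \ {v}) ?_ hq (hcl.subset (Finset.coe_subset.2 Finset.sdiff_subset))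
    rw [Finset.sdiff_singleton_eq_erase]
    exact Finset.erase_ssubset (hvσ (Finset.mem_singleton_self v))

omit [Fintype V] [DecidableEq V] in
lemma IsFlagFor.eq_cliqueComplex {Δ : AbstractSimplicialComplex V} {G : SimpleGraph V}
    (h : IsFlagFor Δ G) : Δ = cliqueComplex G := by
  refine SetLike.ext fun σ => ?_
  change σ ∈ Δ ↔ σ.Nonempty ∧ G.IsClique (σ : Set V)
  constructor
  · intro hσ
    refine ⟨(Δ.isRelLowerSet_faces hσ).1, ?_⟩
    by_contra hcl
    exact ((h σ).2 hcl).2 hσ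
  · rintro ⟨hne, hcl⟩
    by_contra hσ
    exact (h σ).1 ⟨hne, hσ⟩ hcl

omit [Fintype V] [DecidableEq V] in
lemma isFlagFor_cliqueComplex (G : SimpleGraph V) : IsFlagFor (cliqueComplex G) G := by
  intro σ
  change (σ.Nonempty ∧ ¬ (σ.Nonempty ∧ G.IsClique (σ : Set V))) ↔ _
  constructor
  · rintro ⟨h1, h2⟩ hcl
    exact h2 ⟨h1, hcl⟩
  · intro hcl
    refine ⟨?_, fun h => hcl h.2⟩
    by_contra hne
    rw [Finset.not_nonempty_iff_eq_empty] at hne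
    subst hne
    exact hcl (by simp)

omit [Fintype V] [DecidableEq V] in
lemma isChordal_iff_forall_not_isMinimalCycle {G : SimpleGraph V} :
    IsChordal G ↔ ∀ (v : V) (c : G.Walk v v), ¬ IsMinimalCycle c := by
  constructor
  · rintro h v c ⟨h1, h2, h3⟩
    obtain ⟨e, he⟩ := h v c h1 h2
    exact h3 he
  · intro h v c h1 h2
    by_contra! h3
    exact h v c ⟨h1, h2, fun e => h3 e⟩

lemma isCMRegular_two_iff (Δ : AbstractSimplicialComplex V) :
    IsCMRegular (stanleyReisnerIdeal k Δ) 2 ↔ ∀ t d, t + 2 < d → TorVanishes k Δ t d := by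
  constructor
  · rintro ⟨F, hF⟩ t d hd
    exact (F.koszulExact_iff t d).2 fun j hj => by have := hF t j; omega
  · intro h
    obtain ⟨F⟩ := nonempty_minimalGradedFreeResolution (I := stanleyReisnerIdeal k Δ)
      fun f hf d => part_mem_stanleyReisnerIdeal Δ hf d
    refine ⟨F, fun t j => ?_⟩
    by_contra! hlt
    exact (F.koszulExact_iff t _).1 (h t _ hlt) j rfl

lemma IsFlagFor.isCMRegular_two_iff {Δ : AbstractSimplicialComplex V} {G : SimpleGraph V}
    (hΔ : IsFlagFor Δ G) : IsCMRegular (stanleyReisnerIdeal k Δ) 2 ↔ IsChordal G := by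
  rw [LinearSyzygies.isCMRegular_two_iff, isChordal_iff_forall_not_isMinimalCycle]
  constructor
  · intro h v c hc
    have := hc.2.1
    exact hΔ.not_torVanishes hc (h _ _ (by omega))
  · intro h t d hd
    exact hΔ.torVanishes (fun u c hc => absurd hc (h u c)) hd

omit [Fintype V] [DecidableEq V] in
/-- The differentials of a minimal free resolution have no zero columns. -/
lemma MinimalGradedFreeResolution.exists_ne_zero {I : Ideal (MvPolynomial V k)}
    (F : MinimalGradedFreeResolution I) (t : ℕ) (j : Fin (F.rank (t + 1))) :
    ∃ i, F.φ t i j ≠ 0 := by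
  by_contra! h
  -- A zero column puts a basis vector into the image of the next differential, which lies in `𝔪 F`.
  have hmem : Pi.single j 1 ∈ LinearMap.range (F.φ (t + 1)).mulVecLin := by
    rw [F.exact_succ t, LinearMap.mem_ker, Matrix.mulVecLin_apply]
    funext i
    simpa using h i
  have := F.constantCoeff_of_mem_range (t + 1) _ hmem j
  simp at this

lemma IsFlagFor.deg_eq {Δ : AbstractSimplicialComplex V} {G : SimpleGraph V} (hΔ : IsFlagFor Δ G)
    (F : MinimalGradedFreeResolution (stanleyReisnerIdeal k Δ)) {t : ℕ}
    (hcyc : ∀ (u : V) (c : G.Walk u u), IsMinimalCycle c → t + 3 < c.length)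
    (j : Fin (F.rank t)) : F.deg t j = t + 2 := by
  by_contra hne
  rcases lt_or_gt_of_ne hne with h | h
  · exact (F.koszulExact_iff t _).1 (torVanishes_of_lt Δ h) j rfl
  · exact (F.koszulExact_iff t _).1 (hΔ.torVanishes hcyc h) j rfl

lemma add_lt_of_lt_of_add_le {t n m : ℕ} {p : ℕ∞} (h : (t : ℕ∞) < p)
    (h' : p + m ≤ (n : ℕ∞)) : t + m < n := by
  cases p with
  | top => simp at h'
  | coe p => norm_cast at h h'; omega

/-- Linear matrices propagate `deg t = t + 2` up to every `t < p`, whereas a minimal cycle of length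
`n` forces a basis element of degree `n` in `F_{n-3}`. Conversely, long minimal cycles put `F_t` and
`F_{t+1}` in degrees `t + 2` and `t + 3`, so the entries between them are linear. -/
lemma IsFlagFor.satisfiesN2_iff {Δ : AbstractSimplicialComplex V} {G : SimpleGraph V}
    (hΔ : IsFlagFor Δ G)
    (hgen : IsGeneratedByQuadraticSquarefreeMonomials (stanleyReisnerIdeal k Δ)) (p : ℕ∞) :
    SatisfiesN2 (stanleyReisnerIdeal k Δ) p ↔
      ∀ (v : V) (c : G.Walk v v), IsMinimalCycle c → p + 3 ≤ (c.length : ℕ∞) := by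
  constructor
  · rintro ⟨-, F, hF⟩ v c hc
    by_contra! hlt
    have hdeg : ∀ t : ℕ, (t : ℕ∞) < p → ∀ j, F.deg t j = t + 2 := by
      intro t
      induction t with
      -- At `t = 0` the bound on cycle lengths is part of the definition of a minimal cycle.
      | zero => exact fun _ => hΔ.deg_eq F fun u c hc => hc.2.1
      | succ t ih =>
        intro ht j
        obtain ⟨i, hi⟩ := F.exists_ne_zero t j
        obtain ⟨m, hm⟩ := support_nonempty.2 hi
        have h1 := F.φ_homogeneous t i j m hm
        have h2 := isHomogeneous_iff_degree.1 (hF t ht i j) m hm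
        have h3 := ih (lt_of_le_of_lt (by norm_cast; omega) ht) i
        omega
    have hlen := hc.2.1
    have hp : ((c.length - 3 : ℕ) : ℕ∞) < p := by
      cases p with
      | top => exact ENat.natCast_lt_top _
      | coe p => norm_cast at hlt ⊢; omega
    refine hΔ.not_torVanishes hc ((F.koszulExact_iff _ _).2 fun j hj => ?_)
    have := hdeg _ hp j
    omega
  · intro h
    refine ⟨?_, ?_⟩
    · refine le_antisymm ?_ (Ideal.span_le.2 fun f hf => hf.1)
      obtain ⟨E, -, hI⟩ := hgen
      conv_lhs => rw [hI]
      refine Ideal.span_mono ?_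
      rintro _ ⟨e, he, rfl⟩
      refine ⟨?_, (isHomogeneous_X k e.1).mul (isHomogeneous_X k e.2)⟩
      rw [hI]
      exact Ideal.subset_span ⟨e, he, rfl⟩
    · obtain ⟨F⟩ := nonempty_minimalGradedFreeResolution (I := stanleyReisnerIdeal k Δ)
        fun f hf d => part_mem_stanleyReisnerIdeal Δ hf d
      refine ⟨F, fun t ht i j => isHomogeneous_iff_degree.2 fun m hm => ?_⟩
      have h1 := F.φ_homogeneous t i j m hm
      have hlong : ∀ (u : V) (c : G.Walk u u), IsMinimalCycle c → t + 1 + 3 < c.length :=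
        fun u c hc => add_lt_of_lt_of_add_le ht (h u c hc)
      have h2 := hΔ.deg_eq F hlong j
      have h3 := hΔ.deg_eq F (t := t) (fun u c hc => by have := hlong u c hc; omega) i
      omega

end StanleyReisner
end LinearSyzygies

theorem theorem2p1 {k : Type*} [Field k] {V : Type*} [Fintype V] [DecidableEq V]
    (Δ : AbstractSimplicialComplex V) :
    (LinearSyzygies.IsGeneratedByQuadraticSquarefreeMonomials
        (LinearSyzygies.stanleyReisnerIdeal k Δ) →
      (∀ p : ℕ∞, 1 < p →
        (LinearSyzygies.SatisfiesN2 (LinearSyzygies.stanleyReisnerIdeal k Δ) p ↔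
          ∀ (v : V) (c : (LinearSyzygies.oneSkeleton Δ).Walk v v),
            LinearSyzygies.IsMinimalCycle c → p + 3 ≤ (c.length : ℕ∞))) ∧
      (LinearSyzygies.IsCMRegular (LinearSyzygies.stanleyReisnerIdeal k Δ) 2 ↔
        LinearSyzygies.IsChordal (LinearSyzygies.oneSkeleton Δ))) ∧
    (LinearSyzygies.IsCMRegular (LinearSyzygies.stanleyReisnerIdeal k Δ) 2 ↔
      ∃ G : SimpleGraph V, LinearSyzygies.IsChordal G ∧ Δ = LinearSyzygies.cliqueComplex G) := by
  refine ⟨fun hgen => ?_, ?_, ?_⟩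
  · have hΔ := LinearSyzygies.isFlagFor_oneSkeleton_of_isGeneratedBy hgen
    exact ⟨fun p _ => hΔ.satisfiesN2_iff hgen p, hΔ.isCMRegular_two_iff⟩
  · intro h
    -- The case `t = 0` of regularity alone makes `Δ` a clique complex.
    have hΔ : LinearSyzygies.IsFlagFor Δ (LinearSyzygies.oneSkeleton Δ) :=
      LinearSyzygies.isFlagFor_oneSkeleton_of_torVanishes (k := k)
        ((LinearSyzygies.isCMRegular_two_iff Δ).1 h 0)
    exact ⟨_, hΔ.isCMRegular_two_iff.1 h, hΔ.eq_cliqueComplex⟩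
  · rintro ⟨G, hG, rfl⟩
    exact (LinearSyzygies.isFlagFor_cliqueComplex G).isCMRegular_two_iff.2 hG
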